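/- **Theorem 1.** Let $\mathcal X$ be a compact metric space with its Borel $\sigma$-field, and let $K:\mathcal X\times\mathcal X\to\mathbb R$ be a Mercer kernel (continuous, symmetric, positive semidefinite) with $K(x,x)\le\kappa^2$ for all $x$. Let $(\mathcal H_K,\|\cdot\|_K)$ be its reproducing kernel Hilbert space and $K_x:=K(x,\cdot)$. Let $z_i=(x_i,y_i)$, $i\ge1$, be a sequence of random variables with values in $\mathcal X\times\mathbb R$ that is stationary, i.e. $(z_t,\dots,z_{t+i})$ and $(z_{t+j},\dots,z_{t+i+j})$ have the same distribution for all $t\ge 1$ and $i,j\ge 0$, and strongly mixing, i.e. $$\alpha_j:=\sup_{k\ge1}\ \sup_{A\in\sigma(z_1,\dots,z_k),\ B\in\sigma(z_{k+j},z_{k+j+1},\dots)}|P(A\cap B)-P(A)P(B)|\longrightarrow0\qquad(j\to\infty).$$ Let $\rho$ be the law of $z_1$, $\rho_X$ its marginal on $\mathcal X$, $f_\rho(x)=\int y\,d\rho(y|x)$ the regression function, $L_Kf=\int_{\mathcal X} K_xf(x)\,d\rho_X(x)$ the integral operator on $\mathcal H_K$ or on $L^2_{\rho_X}$, and $\mathcal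 N(\lambda)=\mathrm{Tr}\big((\lambda I+L_K)^{-1}L_K\big)$ for $\lambda>0$. Suppose that * $|y|\le M$ almost surely, for some $M>0$; * $\mathcal N(\lambda)\le C_0\lambda^{-s}$ for all $\lambda>0$, with some $C_0\ge1$ and $0<s\le1$; * $f_\rho=L_K^rh_\rho$ in $L^2_{\rho_X}$, with $1/2\le r\le1$ and some $h_\rho\in L^2_{\rho_X}$, where $L_K^r$ is the $r$-th power of $L_K:L^2_{\rho_X}\to L^2_{\rho_X}$. Then there is a (necessarily unique) function of least norm in $\mathcal H_K$ among those that equal $f_\rho$ $\rho_X$-almost everywhere (the only such function if $\rho_X$ has full support); it is again denoted by $f_\rho$. Let $D=\{z_1,\dots,z_{|D|}\}$ consist of the first $|D|\ge1$ samples, let $\lambda=|D|^{-1/(2r+s)}$, and let $$f_{D,\lambda}=\arg\min_{f\in\mathcal H_K}\Big\{\frac1{|D|}\sum_{(x,y)\in D}(f(x)-y)^2+\lambda\|f\|_K^2\Big\}.$$ Then, for every $\delta>0$, $\|f_{D,\lambda}-f_\rho\|_K$ is integrable and $$E\big[\|f_{D,\lambda}-f_\rho\|_K\big]\le C\Big(1+|D|^{\frac{(s+1)(\delta+1)}{(2r+s)(\delta+2)}}\sum_{\ell=1}^{|D|}\alpha_\ell^{\frac{\delta}{4+2\delta}}\Big)\Big(|D|^{-\frac{r-1/2}{2r+s}}+|D|^{\frac{2(s+1)(\delta+1)+\delta+2}{(2r+s)(2\delta+4)}}\sum_{\ell=1}^{|D|}\alpha_\ell^{\frac{\delta}{4+2\delta}}\Big),$$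 where the constant $C$ depends only on $\kappa$, $M$, $C_0$, $\delta$, $r$, $s$ and an upper bound $R$ for the norm of $h_\rho$ in $L^2_{\rho_X}$; in particular it is independent of $|D|$. -/

import Mathlib

open MeasureTheory ProbabilityTheory Filter Topology
open scoped ENNReal

namespace KRR

noncomputable section

/-! ### Stationary and strongly mixing sequences

Sequences are indexed by `ℕ`, starting from `0`. -/

/-- Stationarity: for all `t`, `i`, `j` the random vectors `(z t, …, z (t + i))` and
`(z (t + j), …, z (t + i + j))` have the same distribution. -/
def IsStationary {Ω Z : Type*} [MeasurableSpace Ω] [MeasurableSpace Z] (P : Measure Ω)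
    (z : ℕ → Ω → Z) : Prop :=
  ∀ t i j : ℕ,
    IdentDistrib (fun ω (k : Fin (i + 1)) => z (t + k) ω)
      (fun ω (k : Fin (i + 1)) => z (t + j + k) ω) P P

/-- The `α`-coefficient `sup_{A ∈ 𝓙, B ∈ 𝓚} |P (A ∩ B) - P A * P B|` of two `σ`-fields. -/
def alphaCoeff {Ω : Type*} [MeasurableSpace Ω] (P : Measure Ω) (J K : MeasurableSpace Ω) : ℝ :=
  sSup {a : ℝ | ∃ A B : Set Ω, MeasurableSet[J] A ∧ MeasurableSet[K] B ∧
    a = |P.real (A ∩ B) - P.real A * P.real B|}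

/-- The `σ`-field generated by `z 0, …, z k`. -/
abbrev pastField {Ω Z : Type*} [MeasurableSpace Z] (z : ℕ → Ω → Z) (k : ℕ) : MeasurableSpace Ω :=
  ⨆ i ∈ Set.Iic k, MeasurableSpace.comap (z i) inferInstance

/-- The `σ`-field generated by `z k, z (k + 1), …`. -/
abbrev futureField {Ω Z : Type*} [MeasurableSpace Z] (z : ℕ → Ω → Z) (k : ℕ) : MeasurableSpace Ω :=
  ⨆ i ∈ Set.Ici k, MeasurableSpace.comap (z i) inferInstance

/-- The `j`-th strong mixing coefficient `α_j` of the sequence `z`. -/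
def mixingCoeff {Ω Z : Type*} [MeasurableSpace Ω] [MeasurableSpace Z] (P : Measure Ω)
    (z : ℕ → Ω → Z) (j : ℕ) : ℝ :=
  ⨆ k : ℕ, alphaCoeff P (pastField z k) (futureField z (k + j))

/-- The strong mixing (`α`-mixing) condition: `α_j → 0`. -/
def IsStronglyMixing {Ω Z : Type*} [MeasurableSpace Ω] [MeasurableSpace Z] (P : Measure Ω)
    (z : ℕ → Ω → Z) : Prop :=
  Tendsto (mixingCoeff P z) atTop (𝓝 0)

/-! ### The reproducing kernel Hilbert space of a Mercer kernel -/

/-- A Mercer kernel: continuous, symmetric and positive semidefinite. -/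
structure IsMercerKernel {X : Type*} [TopologicalSpace X] (K : X → X → ℝ) : Prop where
  continuous : Continuous fun p : X × X => K p.1 p.2
  symm : ∀ x y, K x y = K y x
  nonneg : ∀ (n : ℕ) (x : Fin n → X) (c : Fin n → ℝ),
    0 ≤ ∑ i, ∑ j, c i * c j * K (x i) (x j)

section RKHS

variable {X : Type*} (H : Type*) [NormedAddCommGroup H] [InnerProductSpace ℝ H] [CompleteSpace H]
  [RKHS ℝ H X ℝ]

/-- The representer in `H` of the evaluation at `x`. -/
def kerSection (x : X) : H := RKHS.kerFun H x (1 : ℝ)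

/-- `H` is the reproducing kernel Hilbert space of `K`: the representer of the evaluation at `x` is
the function `K x = K(x, ·)`. -/
def IsRKHSOf (K : X → X → ℝ) : Prop := ∀ x y, kerSection H x y = K x y

variable {H}

theorem inner_kerSection (f : H) (x : X) : inner ℝ (kerSection H x) f = f x := by
  simp [kerSection]

variable [TopologicalSpace X] {K : X → X → ℝ}

theorem continuous_kerSection (hK : IsMercerKernel K) (hH : IsRKHSOf H K) :
    Continuous (kerSection H : X → H) := by
  have key : ∀ x y, ‖kerSection H x - kerSection H y‖ ^ 2 = K x x - 2 * K x y + K y y := by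
    intro x y
    rw [norm_sub_sq_real, ← real_inner_self_eq_norm_sq, ← real_inner_self_eq_norm_sq]
    simp only [inner_kerSection]
    rw [hH, hH, hH, hK.symm y x]
  rw [continuous_iff_continuousAt]
  intro y
  rw [ContinuousAt, tendsto_iff_norm_sub_tendsto_zero]
  have h1 : Tendsto (fun x => K x x - 2 * K x y + K y y) (𝓝 y) (𝓝 0) := by
    have h2 : Continuous fun x => K x x - 2 * K x y + K y y :=
      ((hK.continuous.comp (continuous_id.prodMk continuous_id)).sub
        (continuous_const.mul (hK.continuous.comp
          (continuous_id.prodMk continuous_const)))).add continuous_const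
    have h3 := h2.tendsto y
    have h4 : K y y - 2 * K y y + K y y = 0 := by ring
    rwa [h4] at h3
  have h5 := (Real.continuous_sqrt.tendsto 0).comp h1
  simp only [Real.sqrt_zero] at h5
  refine h5.congr fun x => ?_
  simp only [Function.comp]
  rw [← key, Real.sqrt_sq (norm_nonneg _)]

theorem continuous_coe (hK : IsMercerKernel K) (hH : IsRKHSOf H K) (f : H) :
    Continuous (f : X → ℝ) := by
  have h : (f : X → ℝ) = fun x => inner ℝ (kerSection H x) f := by
    funext x; rw [inner_kerSection]
  rw [h]
  exact (continuous_kerSection hK hH).inner continuous_const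

end RKHS

/-! ### The integral operator -/

section IntegralOperator

set_option linter.unusedSectionVars false

variable {X : Type*} [MetricSpace X] [CompactSpace X] [MeasurableSpace X] [BorelSpace X]
  {H : Type*} [NormedAddCommGroup H] [InnerProductSpace ℝ H] [CompleteSpace H] [RKHS ℝ H X ℝ]
  {K : X → X → ℝ}

theorem exists_bound_kerSection (hK : IsMercerKernel K) (hH : IsRKHSOf H K) :
    ∃ B : ℝ, 0 ≤ B ∧ ∀ x : X, ‖kerSection H x‖ ≤ B := by
  obtain ⟨B, hB⟩ := (isCompact_univ (X := X)).exists_bound_of_continuousOn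
    (continuous_kerSection hK hH).continuousOn
  exact ⟨max B 0, le_max_right _ _, fun x => (hB x trivial).trans (le_max_left _ _)⟩

theorem memLp_coe (hK : IsMercerKernel K) (hH : IsRKHSOf H K) (μ : Measure X)
    [IsFiniteMeasure μ] (f : H) : MemLp (f : X → ℝ) 2 μ := by
  obtain ⟨B, -, hB⟩ := exists_bound_kerSection hK hH
  refine MemLp.of_bound (continuous_coe hK hH f).aestronglyMeasurable (B * ‖f‖) ?_
  refine Eventually.of_forall fun x => ?_
  rw [← inner_kerSection]
  exact (norm_inner_le_norm _ _).trans (mul_le_mul_of_nonneg_right (hB x) (norm_nonneg _))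

/-- The inclusion `H → L²(μ)`, which sends a function of `H` to its class. -/
def toL2 (hK : IsMercerKernel K) (hH : IsRKHSOf H K) (μ : Measure X) [IsFiniteMeasure μ] :
    H →L[ℝ] Lp ℝ 2 μ :=
  LinearMap.mkContinuousOfExistsBound
    { toFun := fun f => (memLp_coe hK hH μ f).toLp (f : X → ℝ)
      map_add' := fun f g => by
        rw [← MemLp.toLp_add]
        exact MemLp.toLp_congr _ _ (by rw [RKHS.coe_add])
      map_smul' := fun c f => by
        rw [RingHom.id_apply, ← MemLp.toLp_const_smul]
        exact MemLp.toLp_congr _ _ (by rw [RKHS.coe_smul]) }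
    (by
      obtain ⟨B, hB0, hB⟩ := exists_bound_kerSection hK hH
      refine ⟨(μ.real Set.univ) ^ ((2 : ℝ≥0∞).toReal)⁻¹ * B, fun f => ?_⟩
      have h := Lp.norm_le_of_ae_bound (p := 2) (μ := μ)
        (f := (memLp_coe hK hH μ f).toLp (f : X → ℝ)) (C := B * ‖f‖) (by positivity) (by
          filter_upwards [(memLp_coe hK hH μ f).coeFn_toLp] with x hx
          rw [hx, ← inner_kerSection]
          exact (norm_inner_le_norm _ _).trans
            (mul_le_mul_of_nonneg_right (hB x) (norm_nonneg _)))
      rw [mul_assoc]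
      exact h)

theorem coeFn_toL2 (hK : IsMercerKernel K) (hH : IsRKHSOf H K) (μ : Measure X)
    [IsFiniteMeasure μ] (f : H) : (toL2 hK hH μ f : X → ℝ) =ᵐ[μ] (f : X → ℝ) :=
  (memLp_coe hK hH μ f).coeFn_toLp

theorem integrable_smul_kerSection (hK : IsMercerKernel K) (hH : IsRKHSOf H K) (μ : Measure X)
    [IsFiniteMeasure μ] (f : Lp ℝ 2 μ) : Integrable (fun x => f x • kerSection H x) μ := by
  obtain ⟨B, -, hB⟩ := exists_bound_kerSection hK hH
  have h1 : Integrable (f : X → ℝ) μ := (Lp.memLp f).integrable one_le_two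
  exact h1.smul_bdd B (continuous_kerSection hK hH).aestronglyMeasurable
    (Eventually.of_forall hB)

theorem inner_integral_smul_kerSection (hK : IsMercerKernel K) (hH : IsRKHSOf H K)
    (μ : Measure X) [IsFiniteMeasure μ] (f : Lp ℝ 2 μ) (g : H) :
    inner ℝ g (∫ x, f x • kerSection H x ∂μ) = inner ℝ (toL2 hK hH μ g) f := by
  rw [← integral_inner (integrable_smul_kerSection hK hH μ f), L2.inner_def]
  refine integral_congr_ae ?_
  filter_upwards [coeFn_toL2 hK hH μ g] with x hx
  rw [hx, inner_smul_right, real_inner_comm, inner_kerSection]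
  simp

/-- The integral operator `f ↦ ∫ K_x f(x) dμ(x)` from `L²(μ)` to `H`. -/
def integralOp (hK : IsMercerKernel K) (hH : IsRKHSOf H K) (μ : Measure X) [IsFiniteMeasure μ] :
    Lp ℝ 2 μ →L[ℝ] H :=
  LinearMap.mkContinuousOfExistsBound
    { toFun := fun f => ∫ x, f x • kerSection H x ∂μ
      map_add' := fun f g => by
        refine ext_inner_left ℝ fun v => ?_
        simp only [inner_add_right, inner_integral_smul_kerSection hK hH]
      map_smul' := fun c f => by
        refine ext_inner_left ℝ fun v => ?_
        simp only [inner_smul_right, inner_integral_smul_kerSection hK hH, RingHom.id_apply] }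
    (by
      refine ⟨‖toL2 hK hH μ‖, fun f => ?_⟩
      change ‖∫ x, f x • kerSection H x ∂μ‖ ≤ _
      set v := ∫ x, f x • kerSection H x ∂μ with hv
      have h1 : ‖v‖ * ‖v‖ ≤ (‖toL2 hK hH μ‖ * ‖f‖) * ‖v‖ := by
        rw [← real_inner_self_eq_norm_mul_norm]
        nth_rewrite 2 [hv]
        rw [inner_integral_smul_kerSection hK hH]
        calc inner ℝ (toL2 hK hH μ v) f ≤ ‖toL2 hK hH μ v‖ * ‖f‖ := real_inner_le_norm _ _
          _ ≤ (‖toL2 hK hH μ‖ * ‖v‖) * ‖f‖ := by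
              gcongr
              exact (toL2 hK hH μ).le_opNorm v
          _ = _ := by ring
      rcases (norm_nonneg v).eq_or_lt with h0 | h0
      · rw [← h0]; positivity
      · exact le_of_mul_le_mul_right h1 h0)

/-- `L_K` as an operator on `H`: `f ↦ ∫ K_x f(x) dμ(x)`. -/
def LKH (hK : IsMercerKernel K) (hH : IsRKHSOf H K) (μ : Measure X) [IsFiniteMeasure μ] :
    H →L[ℝ] H :=
  integralOp hK hH μ ∘L toL2 hK hH μ

/-- `L_K` as an operator on `L²(μ)`: `f ↦ ∫ K_x f(x) dμ(x)`. -/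
def LK2 (hK : IsMercerKernel K) (hH : IsRKHSOf H K) (μ : Measure X) [IsFiniteMeasure μ] :
    Lp ℝ 2 μ →L[ℝ] Lp ℝ 2 μ :=
  toL2 hK hH μ ∘L integralOp hK hH μ

end IntegralOperator

/-! ### Powers, trace and effective dimension -/

section Operators

variable {E : Type*} [NormedAddCommGroup E] [InnerProductSpace ℝ E] [CompleteSpace E]

/-- `g = T ^ r h`, for a compact positive operator `T` and `r > 0`: the spectral expansion
`g = ∑ σ ^ r • P_σ h`, where `P_σ` is the orthogonal projection onto the eigenspace
`ker (T - σ)`, which is zero unless `σ` is an eigenvalue. -/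
def IsPowApply (T : E →L[ℝ] E) (r : ℝ) (h g : E) : Prop :=
  HasSum (fun σ : ℝ =>
    σ ^ r • (T - σ • ContinuousLinearMap.id ℝ E).ker.starProjection h) g

/-- The trace `∑ ⟪e_i, A e_i⟫` of a positive operator `A`, a number in `[0, ∞]`, computed in a
Hilbert basis; it does not depend on the basis. -/
def posTrace (A : E →L[ℝ] E) : ℝ≥0∞ :=
  ∑' i, ENNReal.ofReal (inner ℝ ((exists_hilbertBasis ℝ E).choose_spec.choose i)
    (A ((exists_hilbertBasis ℝ E).choose_spec.choose i)))

/-- The effective dimension `Tr ((lam I + L)⁻¹ L)` of a positive operator `L`; the operator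
`lam I + L` is invertible since `lam > 0`. -/
def effectiveDim (L : E →L[ℝ] E) (lam : ℝ) : ℝ≥0∞ :=
  posTrace (Ring.inverse (lam • (1 : E →L[ℝ] E) + L) * L)

end Operators

/-! ### Kernel ridge regression -/

section Regression

variable {X : Type*} {H : Type*} [NormedAddCommGroup H] [InnerProductSpace ℝ H] [CompleteSpace H]
  [RKHS ℝ H X ℝ]

/-- The regularized empirical risk `(1 / n) ∑ (f x_i - y_i) ^ 2 + lam ‖f‖ ^ 2`. -/
def ridgeRisk {n : ℕ} (D : Fin n → X × ℝ) (lam : ℝ) (f : H) : ℝ :=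
  (1 / (n : ℝ)) * ∑ i, (f (D i).1 - (D i).2) ^ 2 + lam * ‖f‖ ^ 2

/-- The regularized empirical risk has exactly one minimizer. -/
theorem existsUnique_minimizer {n : ℕ} (D : Fin n → X × ℝ) {lam : ℝ} (hlam : 0 < lam) :
    ∃! f : H, ∀ g : H, ridgeRisk D lam f ≤ ridgeRisk D lam g := by
  let k : Fin n → H := fun i => kerSection H (D i).1
  let B : H →L[ℝ] H →L[ℝ] ℝ := lam • isBoundedBilinearMap_inner.toContinuousLinearMap +
    (1 / (n : ℝ)) • ∑ i, (innerSL ℝ (k i)).smulRight (innerSL ℝ (k i))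
  have hB : ∀ f g : H, B f g = lam * inner ℝ f g + (1 / (n : ℝ)) * ∑ i, f (D i).1 * g (D i).1 := by
    intro f g
    simp [B, k, inner_kerSection]
  have hc : IsCoercive B := by
    refine ⟨lam, hlam, fun u => ?_⟩
    rw [hB, real_inner_self_eq_norm_mul_norm, mul_assoc]
    have : 0 ≤ (1 / (n : ℝ)) * ∑ i, u (D i).1 * u (D i).1 :=
      mul_nonneg (by positivity) (Finset.sum_nonneg fun i _ => mul_self_nonneg _)
    linarith
  let f : H := hc.continuousLinearEquivOfBilin.symm ((1 / (n : ℝ)) • ∑ i, (D i).2 • k i)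
  have hf : ∀ g : H, B f g = (1 / (n : ℝ)) * ∑ i, (D i).2 * g (D i).1 := by
    intro g
    rw [← hc.continuousLinearEquivOfBilin_apply, ContinuousLinearEquiv.apply_symm_apply]
    simp only [k, inner_smul_left, sum_inner, inner_kerSection]
    simp
  have key : ∀ g : H, ridgeRisk D lam f + lam * ‖g - f‖ ^ 2 ≤ ridgeRisk D lam g := by
    intro g
    obtain ⟨d, rfl⟩ : ∃ d, g = f + d := ⟨g - f, by abel⟩
    have h1 := hf d
    rw [hB] at h1
    have h2 : 0 ≤ (1 / (n : ℝ)) * ∑ i, d (D i).1 ^ 2 :=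
      mul_nonneg (by positivity) (Finset.sum_nonneg fun i _ => sq_nonneg _)
    have h3 : ∑ i, ((f + d) (D i).1 - (D i).2) ^ 2 = ∑ i, (f (D i).1 - (D i).2) ^ 2 +
        2 * ∑ i, f (D i).1 * d (D i).1 - 2 * ∑ i, (D i).2 * d (D i).1 + ∑ i, d (D i).1 ^ 2 := by
      rw [Finset.mul_sum, Finset.mul_sum, ← Finset.sum_add_distrib, ← Finset.sum_sub_distrib,
        ← Finset.sum_add_distrib]
      refine Finset.sum_congr rfl fun i _ => ?_
      rw [RKHS.coe_add, Pi.add_apply]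
      ring
    unfold ridgeRisk
    rw [h3, add_sub_cancel_left, norm_add_sq_real]
    linarith
  refine ⟨f, fun g => (le_add_of_nonneg_right (by positivity)).trans (key g), fun g hg => ?_⟩
  have h1 := (key g).trans (hg f)
  have h2 : lam * ‖g - f‖ ^ 2 ≤ 0 := by linarith
  have h3 : ‖g - f‖ ^ 2 ≤ 0 := by
    by_contra hh
    push Not at hh
    exact absurd h2 (not_le.mpr (mul_pos hlam hh))
  exact sub_eq_zero.mp (norm_eq_zero.mp (pow_eq_zero_iff two_ne_zero |>.mp
    (le_antisymm h3 (sq_nonneg _))))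

variable (H) in
/-- The kernel ridge regression estimator: the minimizer of the regularized empirical risk. -/
def krr {n : ℕ} (D : Fin n → X × ℝ) (lam : ℝ) : H :=
  Classical.epsilon fun f : H => ∀ g : H, ridgeRisk D lam f ≤ ridgeRisk D lam g

/-- The regression function `x ↦ ∫ y dρ(y | x)`. -/
def regressionFun [MeasurableSpace X] (ρ : Measure (X × ℝ)) [IsFiniteMeasure ρ] (x : X) : ℝ :=
  ∫ y, y ∂(ρ.condKernel x)

/-- `f` is the version of `φ` in `H`: it agrees with `φ` almost everywhere and has the least norm
among the functions in `H` that do. There is at most one such `f`; it is the only function in `H`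
equal to `φ` almost everywhere if `μ` has full support. -/
def IsVersion [MeasurableSpace X] (μ : Measure X) (φ : X → ℝ) (f : H) : Prop :=
  (f : X → ℝ) =ᵐ[μ] φ ∧ ∀ g : H, (g : X → ℝ) =ᵐ[μ] φ → ‖f‖ ≤ ‖g‖

end Regression

end

end KRR

/-! Let `f` be the least-norm version of the regression function, T the integral operator on H, T_D
its empirical counterpart `empOp`, G = (λ + T)⁻¹ and fl = GTf. Let Δ be the sample mean of (y -
fl(x)) K_x minus its expectation T(f - fl). The estimator satisfies

f_D - f = -λGf + GΔ + w, where (λ + T_D) w = -(T_D - T)GΔ.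

The first term is the bias, of size λ^(r-1/2) ‖h‖ by a spectral estimate
(`exists_version_of_isPowApply`). Since T_D is positive, ‖w‖ ≤ λ⁻¹ ‖(T_D - T)GΔ‖, so (λ + T_D)⁻¹
never has to be compared with G. With a map Φ such that Φ†Φ = G this yields

‖f_D - f‖ ≤ bias + W₁/√λ + W₁W₂/λ (`norm_krr_sub_le`),

where W₁ = ‖ΦΔ‖ and W₂ is the deviation of the sample mean of the tensors K_x ⊗ ΦK_x. By the
inequality of arithmetic and geometric means, only E W₁² and E W₂² are needed.

Both are variances of sample means of bounded Hilbert-space valued functions of a stationary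
sequence. Such a variance is at most 1/n times the second moment plus 56 B² ∑ √α_l, with B a uniform
bound (`integral_norm_sq_mean_sub_le`). The second moment of ΦK_x is controlled by the effective
dimension, hence by C₀ λ^(-s); its square is at most κ²/λ everywhere.

The variance bound rests on a dimension-free covariance inequality
(`abs_integral_inner_sub_le_sqrt`): an inner product is the average over random signs of products of
scalar signed sums. These have fourth moments bounded independently of the dimension, so they can be
truncated, and the scalar covariance inequality applies to the truncations.

For λ = n^(-1/(2r+s)) the result is a multiple of λ^(r-1/2) (1 + λ^(s-1) ∑ √α_l). Since √α ≤
α^(δ/(4+2δ)), comparing exponents gives the stated bound (`error_bound_le`, `rate_le`). -/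

namespace KRR

noncomputable section

/-! ### Averages over random signs -/

section Signs

/-- The signed sum `∑ ± a i`, with signs given by `ε`. -/
def signSum {d : ℕ} (ε : Fin d → Bool) (a : Fin d → ℝ) : ℝ :=
  ∑ i, if ε i then a i else - a i

theorem sum_signs_succ {d : ℕ} (f : (Fin (d + 1) → Bool) → ℝ) :
    ∑ ε, f ε = ∑ ε : Fin d → Bool, (f (Fin.cons true ε) + f (Fin.cons false ε)) := by
  rw [← (Fin.consEquiv fun _ : Fin (d + 1) => Bool).sum_comp, Fintype.sum_prod_type,
    Fintype.sum_bool, ← Finset.sum_add_distrib]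
  rfl

theorem signSum_cons {d : ℕ} (b : Bool) (ε : Fin d → Bool) (a : Fin (d + 1) → ℝ) :
    signSum (Fin.cons b ε : Fin (d + 1) → Bool) a =
      (if b then a 0 else - a 0) + signSum ε (fun i => a i.succ) := by
  simp [signSum, Fin.sum_univ_succ]

/-- Cross terms cancel under fair independent signs, so the averaged product is the inner product.
This turns a vector covariance into an average of scalar ones. -/
theorem sum_signSum_mul_signSum {d : ℕ} (a b : Fin d → ℝ) :
    ∑ ε, signSum ε a * signSum ε b = 2 ^ d * ∑ i, a i * b i := by
  induction d with
  | zero => simp [signSum]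
  | succ d ih =>
    rw [sum_signs_succ]
    simp only [signSum_cons, if_true, Bool.false_eq_true, if_false]
    have h : ∀ ε : Fin d → Bool,
        (a 0 + signSum ε fun i => a i.succ) * (b 0 + signSum ε fun i => b i.succ) +
        (-a 0 + signSum ε fun i => a i.succ) * (-b 0 + signSum ε fun i => b i.succ) =
        2 * (a 0 * b 0) + 2 * ((signSum ε fun i => a i.succ) * signSum ε fun i => b i.succ) :=
      fun ε => by ring
    rw [Finset.sum_congr rfl fun ε _ => h ε, Finset.sum_add_distrib, ← Finset.mul_sum Finset.univ (fun ε => signSum ε _ * signSum ε _), ih,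
      Fin.sum_univ_succ]
    simp
    ring

/-- Khinchine's inequality for exponent four. Averaging over the first sign kills odd powers and
leaves x⁴ + 6x²S² + S⁴; by induction its mean is at most x⁴ + 6x²Q + 3Q² ≤ 3(x² + Q)², where Q is
the square sum of the remaining entries. -/
theorem sum_signSum_pow_four_le {d : ℕ} (a : Fin d → ℝ) :
    ∑ ε, signSum ε a ^ 4 ≤ 2 ^ d * (3 * (∑ i, a i ^ 2) ^ 2) := by
  induction d with
  | zero => simp [signSum]
  | succ d ih =>
    rw [sum_signs_succ]
    simp only [signSum_cons, if_true, Bool.false_eq_true, if_false]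
    have h : ∀ ε : Fin d → Bool,
        (a 0 + signSum ε fun i => a i.succ) ^ 4 + (-a 0 + signSum ε fun i => a i.succ) ^ 4 =
        2 * a 0 ^ 4 + 12 * a 0 ^ 2 * ((signSum ε fun i => a i.succ) * signSum ε fun i => a i.succ)
          + 2 * (signSum ε fun i => a i.succ) ^ 4 :=
      fun ε => by ring
    rw [Finset.sum_congr rfl fun ε _ => h ε, Finset.sum_add_distrib, Finset.sum_add_distrib,
      ← Finset.mul_sum, ← Finset.mul_sum, ← Finset.mul_sum, sum_signSum_mul_signSum, Fin.sum_univ_succ]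
    have h1 := ih fun i => a i.succ
    have h2 : ∑ i : Fin d, a i.succ * a i.succ = ∑ i : Fin d, a i.succ ^ 2 :=
      Finset.sum_congr rfl fun i _ => by ring
    rw [h2]
    set S := ∑ i : Fin d, a i.succ ^ 2
    simp only [Finset.sum_const, Finset.card_univ, Fintype.card_pi, Fintype.card_bool,
      Finset.prod_const, Fintype.card_fin, nsmul_eq_mul, Nat.cast_pow, Nat.cast_ofNat]
    have h3 : (0 : ℝ) ≤ 2 ^ d * (4 * a 0 ^ 4) := by positivity
    rw [pow_succ (2 : ℝ) d]
    nlinarith [h1, h3]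

end Signs

/-! ### Truncation -/

section Clip

/-- Truncation of a real number at level `L`. -/
def clip (L x : ℝ) : ℝ := max (-L) (min L x)

theorem abs_clip_le {L : ℝ} (hL : 0 ≤ L) (x : ℝ) : |clip L x| ≤ L := by
  rw [abs_le, clip]
  exact ⟨le_max_left _ _, max_le (by linarith) (min_le_left _ _)⟩

theorem clip_of_abs_le {L x : ℝ} (h : |x| ≤ L) : clip L x = x := by
  rw [abs_le] at h
  rw [clip, min_eq_right h.2, max_eq_right h.1]

theorem continuous_clip (L : ℝ) : Continuous (clip L) := by
  unfold clip; fun_prop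

theorem abs_clip_le_abs {L : ℝ} (hL : 0 ≤ L) (x : ℝ) : |clip L x| ≤ |x| := by
  rcases le_total |x| L with h | h
  · rw [clip_of_abs_le h]
  · exact (abs_clip_le hL x).trans h

/-- Nothing is cut when |x| ≤ L; otherwise at most |x| is cut and L² ≤ x². -/
theorem sq_mul_abs_sub_clip_le {L : ℝ} (hL : 0 ≤ L) (x : ℝ) :
    L ^ 2 * |x - clip L x| ≤ |x| ^ 3 := by
  rcases le_total |x| L with h | h
  · rw [clip_of_abs_le h]; simp
  · have h1 : |x - clip L x| ≤ |x| := by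
      rcases abs_cases x with ⟨hx, hx'⟩ | ⟨hx, hx'⟩
      · rw [hx] at h
        rw [clip, min_eq_left h, max_eq_right (by linarith), hx, abs_of_nonneg] <;> linarith
      · rw [hx] at h
        rw [clip, min_eq_right (by linarith), max_eq_left (by linarith), hx, abs_of_nonpos] <;>
          linarith
    calc L ^ 2 * |x - clip L x| ≤ |x| ^ 2 * |x| := by gcongr
      _ = |x| ^ 3 := by ring

/-- Writing the difference as (x - clip x) clip y + x (y - clip y) truncates one factor at a time.
Fourth powers are the target because the sign average controls them. -/
theorem sq_mul_abs_mul_sub_clip_mul_clip_le {L : ℝ} (hL : 0 ≤ L) (x y : ℝ) :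
    L ^ 2 * |x * y - clip L x * clip L y| ≤ 2 * (x ^ 4 + y ^ 4) := by
  have h1 : |x * y - clip L x * clip L y| ≤ |x - clip L x| * |y| + |x| * |y - clip L y| := by
    have : x * y - clip L x * clip L y =
        (x - clip L x) * clip L y + x * (y - clip L y) := by ring
    rw [this]
    refine (abs_add_le _ _).trans ?_
    rw [abs_mul, abs_mul]
    exact add_le_add_left (mul_le_mul_of_nonneg_left (abs_clip_le_abs hL y) (abs_nonneg _)) _
  have h2 : |x| ^ 3 * |y| + |x| * |y| ^ 3 ≤ 2 * (|x| ^ 4 + |y| ^ 4) := by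
    nlinarith [sq_nonneg (|x| ^ 2 - |y| ^ 2), sq_nonneg (|x| - |y|), sq_nonneg (|x| ^ 2 - |x| * |y|),
      sq_nonneg (|y| ^ 2 - |x| * |y|), abs_nonneg x, abs_nonneg y,
      mul_nonneg (abs_nonneg x) (abs_nonneg y)]
  have h3 : |x| ^ 4 = x ^ 4 := by rw [← abs_pow, abs_of_nonneg (by positivity)]
  have h4 : |y| ^ 4 = y ^ 4 := by rw [← abs_pow, abs_of_nonneg (by positivity)]
  rw [← h3, ← h4]
  refine le_trans ?_ h2
  calc L ^ 2 * |x * y - clip L x * clip L y|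
      ≤ L ^ 2 * (|x - clip L x| * |y| + |x| * |y - clip L y|) := by gcongr
    _ = (L ^ 2 * |x - clip L x|) * |y| + |x| * (L ^ 2 * |y - clip L y|) := by ring
    _ ≤ |x| ^ 3 * |y| + |x| * |y| ^ 3 := by
      gcongr
      · exact sq_mul_abs_sub_clip_le hL x
      · exact sq_mul_abs_sub_clip_le hL y

end Clip

/-! ### Covariance inequalities -/

section Covariance

variable {Ω : Type*}

/-- The covariance of `U` with `V` is controlled by the covariances of the indicators of the
`m`-measurable sets with `V`. -/
theorem abs_integral_mul_sub_le {m : MeasurableSpace Ω} [m0 : MeasurableSpace Ω] {P : Measure Ω}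
    [IsProbabilityMeasure P] (hm : m ≤ m0) {U V : Ω → ℝ} {L c : ℝ}
    (hL : 0 ≤ L) (hU : StronglyMeasurable[m] U) (hUL : ∀ ω, |U ω| ≤ L) (hV : Integrable V P)
    (hc : ∀ A, MeasurableSet[m] A → |(∫ ω in A, V ω ∂P) - P.real A * ∫ ω, V ω ∂P| ≤ c) :
    |(∫ ω, U ω * V ω ∂P) - (∫ ω, U ω ∂P) * ∫ ω, V ω ∂P| ≤ 2 * L * c := by
  have hUi : Integrable U P := Integrable.of_bound (hU.mono hm).aestronglyMeasurable L
    (Eventually.of_forall hUL)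
  have hUV : Integrable (U * V) P := hV.bdd_mul (hU.mono hm).aestronglyMeasurable
    (Eventually.of_forall hUL)
  -- Against the `m`-measurable U, only the conditional expectation of V matters: the covariance is
  -- the integral of U * W, at most L E|W|.
  set W : Ω → ℝ := fun ω => (P[V | m]) ω - ∫ ω, V ω ∂P with hW
  have hWi : Integrable W P := integrable_condExp.sub (integrable_const _)
  have hWm : StronglyMeasurable[m] W := stronglyMeasurable_condExp.sub stronglyMeasurable_const
  have h1 : (∫ ω, U ω * V ω ∂P) - (∫ ω, U ω ∂P) * ∫ ω, V ω ∂P = ∫ ω, U ω * W ω ∂P := by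
    have e1 : ∫ ω, U ω * V ω ∂P = ∫ ω, U ω * (P[V | m]) ω ∂P := by
      change ∫ ω, (U * V) ω ∂P = _
      rw [← integral_condExp hm]
      exact integral_congr_ae (condExp_mul_of_stronglyMeasurable_left hU hUV hV)
    have e2 : Integrable (fun ω => U ω * (P[V | m]) ω) P :=
      integrable_condExp.bdd_mul (hU.mono hm).aestronglyMeasurable (Eventually.of_forall hUL)
    simp only [hW, mul_sub]
    rw [integral_sub e2 (hUi.mul_const _), integral_mul_const, e1]
  have hset : ∀ A, MeasurableSet[m] A →
      ∫ ω in A, W ω ∂P = (∫ ω in A, V ω ∂P) - P.real A * ∫ ω, V ω ∂P := by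
    intro A hA
    rw [hW, integral_sub integrable_condExp.integrableOn (integrable_const _).integrableOn,
      setIntegral_condExp hm hV hA]
    simp
  -- This set and its complement are `m`-measurable, so each half of E|W| is, up to sign, the
  -- covariance of V with an indicator; hence the factor 2.
  set A : Set Ω := {ω | 0 ≤ W ω} with hAdef
  have hA : MeasurableSet[m] A := hWm.measurable measurableSet_Ici
  have h2 : ∫ ω, |W ω| ∂P ≤ 2 * c := by
    rw [← integral_add_compl (hm A hA) hWi.abs]
    have e1 : ∫ ω in A, |W ω| ∂P = ∫ ω in A, W ω ∂P :=
      setIntegral_congr_fun (hm A hA) fun ω hω => abs_of_nonneg hω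
    have e2 : ∫ ω in Aᶜ, |W ω| ∂P = - ∫ ω in Aᶜ, W ω ∂P := by
      rw [← integral_neg]
      refine setIntegral_congr_fun (hm A hA).compl fun ω hω => abs_of_nonpos ?_
      simp only [hAdef, Set.mem_compl_iff, Set.mem_ofPred_eq, not_le] at hω
      exact hω.le
    rw [e1, e2, hset A hA, hset _ hA.compl]
    have b1 := (abs_le.mp (hc A hA)).2
    have b2 := (abs_le.mp (hc _ hA.compl)).1
    linarith
  rw [h1]
  calc |∫ ω, U ω * W ω ∂P| ≤ ∫ ω, |U ω * W ω| ∂P := abs_integral_le_integral_abs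
    _ ≤ ∫ ω, L * |W ω| ∂P := by
      refine integral_mono_of_nonneg (Eventually.of_forall fun _ => abs_nonneg _)
        (hWi.abs.const_mul L) (Eventually.of_forall fun ω => ?_)
      simp only [abs_mul]
      gcongr
      exact hUL ω
    _ = L * ∫ ω, |W ω| ∂P := integral_const_mul _ _
    _ ≤ L * (2 * c) := by gcongr
    _ = 2 * L * c := by ring

/-- The covariance inequality for bounded real random variables. -/
theorem abs_covariance_le {m₁ m₂ : MeasurableSpace Ω} [m0 : MeasurableSpace Ω] {P : Measure Ω}
    [IsProbabilityMeasure P] (h₁ : m₁ ≤ m0) (h₂ : m₂ ≤ m0) {a : ℝ}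
    (ha : ∀ A B, MeasurableSet[m₁] A → MeasurableSet[m₂] B →
      |P.real (A ∩ B) - P.real A * P.real B| ≤ a)
    {U V : Ω → ℝ} {L : ℝ} (hL : 0 ≤ L)
    (hU : StronglyMeasurable[m₁] U) (hUL : ∀ ω, |U ω| ≤ L)
    (hV : StronglyMeasurable[m₂] V) (hVL : ∀ ω, |V ω| ≤ L) :
    |(∫ ω, U ω * V ω ∂P) - (∫ ω, U ω ∂P) * ∫ ω, V ω ∂P| ≤ 4 * a * L ^ 2 := by
  have hVi : Integrable V P := Integrable.of_bound (hV.mono h₂).aestronglyMeasurable L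
    (Eventually.of_forall hVL)
  -- The bound is used twice: first U is traded for indicators of sets A, then V is paired with the
  -- indicator of A. Each use costs 2L, giving 4aL².
  refine (abs_integral_mul_sub_le h₁ (c := 2 * L * a) hL hU hUL hVi fun A hA => ?_).trans_eq
    (by ring)
  have hA' := h₁ A hA
  have h3 : Integrable (A.indicator fun _ => (1 : ℝ)) P :=
    (integrable_const (1 : ℝ)).indicator hA'
  have h4 := abs_integral_mul_sub_le h₂ (U := V) (V := A.indicator fun _ => (1 : ℝ)) (c := a) hL
    hV hVL h3 fun B hB => ?_
  · have e1 : ∫ ω, V ω * A.indicator (fun _ => (1 : ℝ)) ω ∂P = ∫ ω in A, V ω ∂P := by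
      rw [← integral_indicator hA']
      refine integral_congr_ae (Eventually.of_forall fun ω => ?_)
      by_cases hω : ω ∈ A <;> simp [hω]
    have e2 : ∫ ω, A.indicator (fun _ => (1 : ℝ)) ω ∂P = P.real A := by
      rw [integral_indicator hA']; simp
    rw [e1, e2, mul_comm (∫ ω, V ω ∂P)] at h4
    exact h4
  · have e2 : ∫ ω, A.indicator (fun _ => (1 : ℝ)) ω ∂P = P.real A := by
      rw [integral_indicator hA']; simp
    have e3 : ∫ ω in B, A.indicator (fun _ => (1 : ℝ)) ω ∂P = P.real (A ∩ B) := by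
      rw [integral_indicator hA', Measure.restrict_restrict hA']; simp
    rw [e2, e3, mul_comm (P.real B)]
    exact ha A B hA hB

end Covariance

/-! ### The covariance inequality in a Hilbert space -/

section HilbertCovariance

variable {V : Type*} [NormedAddCommGroup V] [InnerProductSpace ℝ V]

/-- The average over random signs of the products of truncated signed coordinate sums. -/
def clippedInner {d : ℕ} (b : OrthonormalBasis (Fin d) ℝ V) (L : ℝ) (u v : V) : ℝ :=
  (2 ^ d : ℝ)⁻¹ * ∑ ε : Fin d → Bool, clip L (signSum ε fun i => inner ℝ (b i) u) *
    clip L (signSum ε fun i => inner ℝ (b i) v)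

theorem continuous_signSum_inner {d : ℕ} (b : OrthonormalBasis (Fin d) ℝ V) (ε : Fin d → Bool) :
    Continuous fun u : V => signSum ε fun i => inner ℝ (b i) u := by
  unfold signSum
  refine continuous_finsetSum _ fun i _ => ?_
  split_ifs <;> fun_prop

/-- For each sign pattern the truncation error is at most 2(x⁴ + y⁴)/L², and both fourth moments
average to at most 3B⁴: 12 = 2(3 + 3). -/
theorem abs_inner_sub_clippedInner_le {d : ℕ} (b : OrthonormalBasis (Fin d) ℝ V) {L B : ℝ}
    (hL : 0 < L) {u v : V} (hu : ‖u‖ ≤ B) (hv : ‖v‖ ≤ B) :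
    |inner ℝ u v - clippedInner b L u v| ≤ 12 * B ^ 4 / L ^ 2 := by
  have h2 : (0 : ℝ) < 2 ^ d := by positivity
  have hsq : ∀ w : V, ∑ i, inner ℝ (b i) w ^ 2 = ‖w‖ ^ 2 := fun w => by
    rw [← b.sum_sq_norm_inner_right]
    simp
  have h4 : ∀ w : V, ‖w‖ ≤ B →
      ∑ ε, (signSum ε fun i => inner ℝ (b i) w) ^ 4 ≤ 2 ^ d * (3 * B ^ 4) := fun w hw => by
    refine (sum_signSum_pow_four_le _).trans ?_
    rw [hsq]
    have : (‖w‖ ^ 2) ^ 2 ≤ B ^ 4 := by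
      rw [← pow_mul]
      exact pow_le_pow_left₀ (norm_nonneg _) hw _
    gcongr
  have h1 : inner ℝ u v - clippedInner b L u v = (2 ^ d : ℝ)⁻¹ * ∑ ε : Fin d → Bool,
      ((signSum ε fun i => inner ℝ (b i) u) * (signSum ε fun i => inner ℝ (b i) v) -
        clip L (signSum ε fun i => inner ℝ (b i) u) *
        clip L (signSum ε fun i => inner ℝ (b i) v)) := by
    rw [Finset.sum_sub_distrib, sum_signSum_mul_signSum, mul_sub, inv_mul_cancel_left₀ h2.ne',
      clippedInner, ← b.sum_inner_mul_inner]
    congr 1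
    exact Finset.sum_congr rfl fun i _ => by rw [real_inner_comm]
  rw [le_div_iff₀ (by positivity), h1, abs_mul, abs_of_pos (inv_pos.mpr h2), mul_assoc,
    inv_mul_le_iff₀ h2]
  calc _ ≤ (∑ ε : Fin d → Bool,
      |(signSum ε fun i => inner ℝ (b i) u) * (signSum ε fun i => inner ℝ (b i) v) -
        clip L (signSum ε fun i => inner ℝ (b i) u) *
        clip L (signSum ε fun i => inner ℝ (b i) v)|) * L ^ 2 := by
        gcongr
        exact Finset.abs_sum_le_sum_abs _ _
    _ ≤ ∑ ε : Fin d → Bool, 2 * ((signSum ε fun i => inner ℝ (b i) u) ^ 4 +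
          (signSum ε fun i => inner ℝ (b i) v) ^ 4) := by
        rw [Finset.sum_mul]
        refine Finset.sum_le_sum fun ε _ => ?_
        rw [mul_comm]
        exact sq_mul_abs_mul_sub_clip_mul_clip_le hL.le _ _
    _ ≤ 2 * (2 ^ d * (3 * B ^ 4) + 2 ^ d * (3 * B ^ 4)) := by
        rw [← Finset.mul_sum, Finset.sum_add_distrib]
        gcongr
        · exact h4 u hu
        · exact h4 v hv
    _ = 2 ^ d * (12 * B ^ 4) := by ring

variable {Ω : Type*}

/-- Every sign pattern gives a pair of scalars bounded by L, and averaging their covariances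
preserves the bound 4aL² in any dimension. Truncation costs 12B⁴/L² twice: in the mean of the inner
product and in the inner product of the means. -/
theorem abs_integral_inner_sub_le_of_finiteDimensional [FiniteDimensional ℝ V]
    {m₁ m₂ : MeasurableSpace Ω} [m0 : MeasurableSpace Ω] {P : Measure Ω}
    [IsProbabilityMeasure P] (h₁ : m₁ ≤ m0) (h₂ : m₂ ≤ m0) {a : ℝ}
    (ha : ∀ A B, MeasurableSet[m₁] A → MeasurableSet[m₂] B →
      |P.real (A ∩ B) - P.real A * P.real B| ≤ a)
    {ξ η : Ω → V} {B L : ℝ} (hL : 0 < L)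
    (hξ : StronglyMeasurable[m₁] ξ) (hξB : ∀ ω, ‖ξ ω‖ ≤ B)
    (hη : StronglyMeasurable[m₂] η) (hηB : ∀ ω, ‖η ω‖ ≤ B) :
    |(∫ ω, inner ℝ (ξ ω) (η ω) ∂P) - inner ℝ (∫ ω, ξ ω ∂P) (∫ ω, η ω ∂P)| ≤
      4 * a * L ^ 2 + 24 * B ^ 4 / L ^ 2 := by
  have : CompleteSpace V := FiniteDimensional.complete ℝ V
  let d := Module.finrank ℝ V
  let b := stdOrthonormalBasis ℝ V
  have hξ' := hξ.mono h₁
  have hη' := hη.mono h₂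
  have hξi : Integrable ξ P := Integrable.of_bound hξ'.aestronglyMeasurable B
    (Eventually.of_forall hξB)
  have hηi : Integrable η P := Integrable.of_bound hη'.aestronglyMeasurable B
    (Eventually.of_forall hηB)
  have hU : ∀ ε, StronglyMeasurable[m₁] fun ω => clip L (signSum ε fun i => inner ℝ (b i) (ξ ω)) :=
    fun ε => ((continuous_clip L).comp (continuous_signSum_inner b ε)).comp_stronglyMeasurable hξ
  have hW : ∀ ε, StronglyMeasurable[m₂] fun ω => clip L (signSum ε fun i => inner ℝ (b i) (η ω)) :=
    fun ε => ((continuous_clip L).comp (continuous_signSum_inner b ε)).comp_stronglyMeasurable hη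
  have hUi : ∀ ε, Integrable (fun ω => clip L (signSum ε fun i => inner ℝ (b i) (ξ ω))) P :=
    fun ε => Integrable.of_bound ((hU ε).mono h₁).aestronglyMeasurable L
      (Eventually.of_forall fun ω => abs_clip_le hL.le _)
  have hWi : ∀ ε, Integrable (fun ω => clip L (signSum ε fun i => inner ℝ (b i) (η ω))) P :=
    fun ε => Integrable.of_bound ((hW ε).mono h₂).aestronglyMeasurable L
      (Eventually.of_forall fun ω => abs_clip_le hL.le _)
  have hUWi : ∀ ε, Integrable (fun ω => clip L (signSum ε fun i => inner ℝ (b i) (ξ ω)) *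
      clip L (signSum ε fun i => inner ℝ (b i) (η ω))) P :=
    fun ε => (hWi ε).bdd_mul ((hU ε).mono h₁).aestronglyMeasurable
      (Eventually.of_forall fun ω => abs_clip_le hL.le _)
  set ρ := 12 * B ^ 4 / L ^ 2 with hρ
  have hmean : ∀ f g : Ω → ℝ, Integrable f P → Integrable g P → (∀ ω, |f ω - g ω| ≤ ρ) →
      |(∫ ω, f ω ∂P) - ∫ ω, g ω ∂P| ≤ ρ := by
    intro f g hf hg hfg
    rw [← integral_sub hf hg]
    have := norm_integral_le_of_norm_le_const (μ := P) (f := fun ω => f ω - g ω) (C := ρ)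
      (Eventually.of_forall hfg)
    simpa using this
  have hq : ∫ ω, clippedInner b L (ξ ω) (η ω) ∂P = (2 ^ d : ℝ)⁻¹ * ∑ ε : Fin d → Bool,
      ∫ ω, clip L (signSum ε fun i => inner ℝ (b i) (ξ ω)) *
        clip L (signSum ε fun i => inner ℝ (b i) (η ω)) ∂P := by
    unfold clippedInner
    rw [integral_const_mul, integral_finsetSum _ fun ε _ => hUWi ε]
  have j1 : |(∫ ω, inner ℝ (ξ ω) (η ω) ∂P) - ∫ ω, clippedInner b L (ξ ω) (η ω) ∂P| ≤ ρ := by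
    refine hmean _ _ ?_ ?_ fun ω => abs_inner_sub_clippedInner_le b hL (hξB ω) (hηB ω)
    · refine Integrable.of_bound (hξ'.inner hη').aestronglyMeasurable (B * B)
        (Eventually.of_forall fun ω => (norm_inner_le_norm _ _).trans ?_)
      exact mul_le_mul (hξB ω) (hηB ω) (norm_nonneg _) ((norm_nonneg _).trans (hξB ω))
    · unfold clippedInner
      exact (integrable_finsetSum _ fun ε _ => hUWi ε).const_mul _
  have k1 : ∀ v, ‖v‖ ≤ B → |inner ℝ (∫ ω, ξ ω ∂P) v - ∫ ω, clippedInner b L (ξ ω) v ∂P| ≤ ρ := by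
    intro v hv
    rw [real_inner_comm, ← integral_inner hξi]
    refine hmean _ _ (hξi.const_inner v) ?_ fun ω => ?_
    · unfold clippedInner
      exact (integrable_finsetSum _ fun ε _ => (hUi ε).mul_const _).const_mul _
    · rw [real_inner_comm]
      exact abs_inner_sub_clippedInner_le b hL (hξB ω) hv
  have hq1 : ∀ v, ∫ ω, clippedInner b L (ξ ω) v ∂P = (2 ^ d : ℝ)⁻¹ * ∑ ε : Fin d → Bool,
      (∫ ω, clip L (signSum ε fun i => inner ℝ (b i) (ξ ω)) ∂P) *
        clip L (signSum ε fun i => inner ℝ (b i) v) := by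
    intro v
    unfold clippedInner
    rw [integral_const_mul, integral_finsetSum _ fun ε _ => (hUi ε).mul_const _]
    simp only [integral_mul_const]
    rfl
  -- The inner product of the means is a double integral over independent ω and ω'. Truncation is
  -- compared inside, pointwise in ω', by `k1`; the outer average adds no further error.
  have k2 : |inner ℝ (∫ ω, ξ ω ∂P) (∫ ω, η ω ∂P) -
      ∫ ω', ∫ ω, clippedInner b L (ξ ω) (η ω') ∂P ∂P| ≤ ρ := by
    rw [← integral_inner hηi]
    refine hmean _ _ (hηi.const_inner _) ?_ fun ω => k1 _ (hηB ω)
    simp only [hq1]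
    exact (integrable_finsetSum _ fun ε _ => (hWi ε).const_mul _).const_mul _
  have hq2 : ∫ ω', ∫ ω, clippedInner b L (ξ ω) (η ω') ∂P ∂P =
      (2 ^ d : ℝ)⁻¹ * ∑ ε : Fin d → Bool,
      (∫ ω, clip L (signSum ε fun i => inner ℝ (b i) (ξ ω)) ∂P) *
        ∫ ω, clip L (signSum ε fun i => inner ℝ (b i) (η ω)) ∂P := by
    simp only [hq1]
    rw [integral_const_mul, integral_finsetSum _ fun ε _ => (hWi ε).const_mul _]
    simp only [integral_const_mul]
    rfl
  have main : |(∫ ω, clippedInner b L (ξ ω) (η ω) ∂P) -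
      ∫ ω', ∫ ω, clippedInner b L (ξ ω) (η ω') ∂P ∂P| ≤ 4 * a * L ^ 2 := by
    have h2 : (0 : ℝ) < 2 ^ d := by positivity
    rw [hq, hq2, ← mul_sub, ← Finset.sum_sub_distrib, abs_mul, abs_of_pos (inv_pos.mpr h2),
      inv_mul_le_iff₀ h2]
    refine (Finset.abs_sum_le_sum_abs _ _).trans ?_
    have := Finset.sum_le_card_nsmul (Finset.univ : Finset (Fin d → Bool)) _ (4 * a * L ^ 2)
      fun ε _ => abs_covariance_le h₁ h₂ ha hL.le (hU ε) (fun ω => abs_clip_le hL.le _) (hW ε)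
        (fun ω => abs_clip_le hL.le _)
    simpa using this
  have e : 24 * B ^ 4 / L ^ 2 = ρ + ρ := by rw [hρ]; ring
  rw [e]
  rw [abs_le] at j1 k2 main ⊢
  constructor <;> linarith [j1.1, j1.2, k2.1, k2.2, main.1, main.2]

/-- The constants do not see the dimension, so the inequality survives approximation by simple
functions, whose finite ranges span a finite-dimensional subspace. -/
theorem abs_integral_inner_sub_le [CompleteSpace V]
    {m₁ m₂ : MeasurableSpace Ω} [m0 : MeasurableSpace Ω] {P : Measure Ω}
    [IsProbabilityMeasure P] (h₁ : m₁ ≤ m0) (h₂ : m₂ ≤ m0) {a : ℝ}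
    (ha : ∀ A B, MeasurableSet[m₁] A → MeasurableSet[m₂] B →
      |P.real (A ∩ B) - P.real A * P.real B| ≤ a)
    {ξ η : Ω → V} {B L : ℝ} (hL : 0 < L)
    (hξ : StronglyMeasurable[m₁] ξ) (hξB : ∀ ω, ‖ξ ω‖ ≤ B)
    (hη : StronglyMeasurable[m₂] η) (hηB : ∀ ω, ‖η ω‖ ≤ B) :
    |(∫ ω, inner ℝ (ξ ω) (η ω) ∂P) - inner ℝ (∫ ω, ξ ω ∂P) (∫ ω, η ω ∂P)| ≤
      4 * a * L ^ 2 + 24 * B ^ 4 / L ^ 2 := by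
  have hB : 0 ≤ B := by
    obtain ⟨ω⟩ : Nonempty Ω := nonempty_of_isProbabilityMeasure P
    exact (norm_nonneg _).trans (hξB ω)
  let s := fun n => hξ.approxBounded B n
  let t := fun n => hη.approxBounded B n
  have hs : ∀ n, StronglyMeasurable[m₁] (s n) := fun n => (s n).stronglyMeasurable
  have ht : ∀ n, StronglyMeasurable[m₂] (t n) := fun n => (t n).stronglyMeasurable
  have hsB : ∀ n ω, ‖s n ω‖ ≤ B := fun n ω => hξ.norm_approxBounded_le hB n ω
  have htB : ∀ n ω, ‖t n ω‖ ≤ B := fun n ω => hη.norm_approxBounded_le hB n ω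
  have hsl : ∀ ω, Tendsto (fun n => s n ω) atTop (𝓝 (ξ ω)) := fun ω =>
    hξ.tendsto_approxBounded_of_norm_le (hξB ω)
  have htl : ∀ ω, Tendsto (fun n => t n ω) atTop (𝓝 (η ω)) := fun ω =>
    hη.tendsto_approxBounded_of_norm_le (hηB ω)
  have step : ∀ n, |(∫ ω, inner ℝ (s n ω) (t n ω) ∂P) - inner ℝ (∫ ω, s n ω ∂P) (∫ ω, t n ω ∂P)| ≤
      4 * a * L ^ 2 + 24 * B ^ 4 / L ^ 2 := by
    intro n
    let S : Submodule ℝ V := Submodule.span ℝ (Set.range (s n) ∪ Set.range (t n))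
    have : FiniteDimensional ℝ S := FiniteDimensional.span_of_finite ℝ
      ((@SimpleFunc.finite_range _ _ m₁ (s n)).union (@SimpleFunc.finite_range _ _ m₂ (t n)))
    have hsS : ∀ ω, ((S.orthogonalProjectionOnto (s n ω) : S) : V) = s n ω := fun ω =>
      Submodule.starProjection_eq_self_iff.mpr (Submodule.subset_span (Or.inl ⟨ω, rfl⟩))
    have htS : ∀ ω, ((S.orthogonalProjectionOnto (t n ω) : S) : V) = t n ω := fun ω =>
      Submodule.starProjection_eq_self_iff.mpr (Submodule.subset_span (Or.inr ⟨ω, rfl⟩))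
    have h := abs_integral_inner_sub_le_of_finiteDimensional (V := S) (P := P) h₁ h₂ ha hL (B := B)
      (ξ := fun ω => S.orthogonalProjectionOnto (s n ω)) (η := fun ω => S.orthogonalProjectionOnto (t n ω))
      (S.orthogonalProjectionOnto.continuous.comp_stronglyMeasurable (hs n))
      (fun ω => (congrArg norm (hsS ω)).trans_le (hsB n ω))
      (S.orthogonalProjectionOnto.continuous.comp_stronglyMeasurable (ht n))
      (fun ω => (congrArg norm (htS ω)).trans_le (htB n ω))
    have i1 : ((∫ ω, S.orthogonalProjectionOnto (s n ω) ∂P : S) : V) = ∫ ω, s n ω ∂P := by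
      rw [← Submodule.subtypeL_apply, ← ContinuousLinearMap.integral_comp_comm]
      · simp only [Submodule.subtypeL_apply, hsS]
      · exact S.orthogonalProjectionOnto.integrable_comp (Integrable.of_bound
          ((hs n).mono h₁).aestronglyMeasurable B (Eventually.of_forall (hsB n)))
    have i2 : ((∫ ω, S.orthogonalProjectionOnto (t n ω) ∂P : S) : V) = ∫ ω, t n ω ∂P := by
      rw [← Submodule.subtypeL_apply, ← ContinuousLinearMap.integral_comp_comm]
      · simp only [Submodule.subtypeL_apply, htS]
      · exact S.orthogonalProjectionOnto.integrable_comp (Integrable.of_bound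
          ((ht n).mono h₂).aestronglyMeasurable B (Eventually.of_forall (htB n)))
    simp only [Submodule.coe_inner, hsS, htS, i1, i2] at h
    exact h
  have l1 : Tendsto (fun n => ∫ ω, s n ω ∂P) atTop (𝓝 (∫ ω, ξ ω ∂P)) :=
    tendsto_integral_of_dominated_convergence (fun _ => B)
      (fun n => ((hs n).mono h₁).aestronglyMeasurable) (integrable_const _)
      (fun n => Eventually.of_forall (hsB n)) (Eventually.of_forall hsl)
  have l2 : Tendsto (fun n => ∫ ω, t n ω ∂P) atTop (𝓝 (∫ ω, η ω ∂P)) :=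
    tendsto_integral_of_dominated_convergence (fun _ => B)
      (fun n => ((ht n).mono h₂).aestronglyMeasurable) (integrable_const _)
      (fun n => Eventually.of_forall (htB n)) (Eventually.of_forall htl)
  have l3 : Tendsto (fun n => ∫ ω, inner ℝ (s n ω) (t n ω) ∂P) atTop
      (𝓝 (∫ ω, inner ℝ (ξ ω) (η ω) ∂P)) :=
    tendsto_integral_of_dominated_convergence (fun _ => B * B)
      (fun n => (((hs n).mono h₁).inner ((ht n).mono h₂)).aestronglyMeasurable)
      (integrable_const _)
      (fun n => Eventually.of_forall fun ω => (norm_inner_le_norm _ _).trans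
        (mul_le_mul (hsB n ω) (htB n ω) (norm_nonneg _) hB))
      (Eventually.of_forall fun ω => (hsl ω).inner (htl ω))
  exact le_of_tendsto (l3.sub (l1.inner l2)).abs (Eventually.of_forall step)

/-- The covariance inequality for bounded random variables in a Hilbert space. -/
theorem abs_integral_inner_sub_le_sqrt [CompleteSpace V]
    {m₁ m₂ : MeasurableSpace Ω} [m0 : MeasurableSpace Ω] {P : Measure Ω}
    [IsProbabilityMeasure P] (h₁ : m₁ ≤ m0) (h₂ : m₂ ≤ m0) {a : ℝ}
    (ha : ∀ A B, MeasurableSet[m₁] A → MeasurableSet[m₂] B →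
      |P.real (A ∩ B) - P.real A * P.real B| ≤ a)
    {ξ η : Ω → V} {B : ℝ}
    (hξ : StronglyMeasurable[m₁] ξ) (hξB : ∀ ω, ‖ξ ω‖ ≤ B)
    (hη : StronglyMeasurable[m₂] η) (hηB : ∀ ω, ‖η ω‖ ≤ B) :
    |(∫ ω, inner ℝ (ξ ω) (η ω) ∂P) - inner ℝ (∫ ω, ξ ω ∂P) (∫ ω, η ω ∂P)| ≤
      28 * √a * B ^ 2 := by
  have ha0 : 0 ≤ a := (abs_nonneg _).trans
    (ha ∅ ∅ (@MeasurableSet.empty _ m₁) (@MeasurableSet.empty _ m₂))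
  have hB : 0 ≤ B := by
    obtain ⟨ω⟩ : Nonempty Ω := nonempty_of_isProbabilityMeasure P
    exact (norm_nonneg _).trans (hξB ω)
  -- The level L = B/a^(1/4) balances the two terms: 4√a B² + 24√a B² = 28√a B². Shifting a and B by
  -- t > 0 covers the cases where one of them vanishes; then t tends to 0.
  have key : ∀ t : ℝ, 0 < t →
      |(∫ ω, inner ℝ (ξ ω) (η ω) ∂P) - inner ℝ (∫ ω, ξ ω ∂P) (∫ ω, η ω ∂P)| ≤
        28 * √(a + t) * (B + t) ^ 2 := by
    intro t ht
    have hat : 0 < a + t := by linarith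
    have hBt : 0 < B + t := by linarith
    have hq : 0 < √√(a + t) := Real.sqrt_pos.mpr (Real.sqrt_pos.mpr hat)
    refine (abs_integral_inner_sub_le h₁ h₂ (a := a + t) (fun A B hA hB => (ha A B hA hB).trans
      (by linarith)) (L := (B + t) / √√(a + t)) (div_pos hBt hq) (B := B + t) hξ
      (fun ω => (hξB ω).trans (by linarith)) hη (fun ω => (hηB ω).trans (by linarith))).trans_eq ?_
    have e1 : √√(a + t) ^ 2 = √(a + t) := Real.sq_sqrt (Real.sqrt_nonneg _)
    have e2 : √(a + t) * √(a + t) = a + t := Real.mul_self_sqrt hat.le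
    have hq' : 0 < √(a + t) := Real.sqrt_pos.mpr hat
    rw [div_pow, e1]
    nth_rewrite 1 [← e2]
    field_simp
    ring
  have hc : ContinuousWithinAt (fun t : ℝ => 28 * √(a + t) * (B + t) ^ 2) (Set.Ioi 0) 0 := by
    apply Continuous.continuousWithinAt
    fun_prop
  have := ge_of_tendsto hc.tendsto (eventually_mem_nhdsWithin.mono fun t ht => key t ht)
  simpa using this

end HilbertCovariance

/-! ### Mixing coefficients and the variance of sample means -/

section Mixing

theorem abs_measureReal_inter_sub_mul_le_one {Ω : Type*} [MeasurableSpace Ω] (P : Measure Ω)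
    [IsProbabilityMeasure P] (A B : Set Ω) : |P.real (A ∩ B) - P.real A * P.real B| ≤ 1 := by
  have h1 : P.real (A ∩ B) ≤ 1 := measureReal_le_one
  have h2 : P.real A * P.real B ≤ 1 :=
    mul_le_one₀ measureReal_le_one measureReal_nonneg measureReal_le_one
  have h3 : 0 ≤ P.real (A ∩ B) := measureReal_nonneg
  have h4 : 0 ≤ P.real A * P.real B := mul_nonneg measureReal_nonneg measureReal_nonneg
  rw [abs_le]
  constructor <;> linarith

theorem alphaCoeff_le_one {Ω : Type*} {J K : MeasurableSpace Ω} [MeasurableSpace Ω]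
    (P : Measure Ω) [IsProbabilityMeasure P] : alphaCoeff P J K ≤ 1 := by
  refine Real.sSup_le ?_ zero_le_one
  rintro a ⟨A, B, -, -, rfl⟩
  exact abs_measureReal_inter_sub_mul_le_one P A B

theorem abs_sub_le_alphaCoeff {Ω : Type*} {J K : MeasurableSpace Ω} [MeasurableSpace Ω]
    (P : Measure Ω) [IsProbabilityMeasure P] {A B : Set Ω}
    (hA : MeasurableSet[J] A) (hB : MeasurableSet[K] B) :
    |P.real (A ∩ B) - P.real A * P.real B| ≤ alphaCoeff P J K := by
  refine le_csSup ⟨1, ?_⟩ ⟨A, B, hA, hB, rfl⟩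
  rintro a ⟨A, B, -, -, rfl⟩
  exact abs_measureReal_inter_sub_mul_le_one P A B

theorem measurable_pastField {Ω Z : Type*} [MeasurableSpace Z] {z : ℕ → Ω → Z} (k : ℕ) :
    Measurable[pastField z k] (z k) :=
  measurable_iff_comap_le.mpr (le_iSup₂_of_le k (Set.mem_Iic.mpr le_rfl) le_rfl)

theorem measurable_futureField {Ω Z : Type*} [MeasurableSpace Z] {z : ℕ → Ω → Z} (k : ℕ) :
    Measurable[futureField z k] (z k) :=
  measurable_iff_comap_le.mpr (le_iSup₂_of_le k (Set.mem_Ici.mpr le_rfl) le_rfl)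

theorem pastField_le {Ω Z : Type*} [MeasurableSpace Z] {z : ℕ → Ω → Z} [m0 : MeasurableSpace Ω]
    (hz : ∀ i, Measurable (z i)) (k : ℕ) :
    pastField z k ≤ m0 :=
  iSup₂_le fun i _ => (hz i).comap_le

theorem futureField_le {Ω Z : Type*} [MeasurableSpace Z] {z : ℕ → Ω → Z} [m0 : MeasurableSpace Ω]
    (hz : ∀ i, Measurable (z i)) (k : ℕ) :
    futureField z k ≤ m0 :=
  iSup₂_le fun i _ => (hz i).comap_le

theorem IsStationary.map_eq {Ω Z : Type*} [MeasurableSpace Ω] [MeasurableSpace Z] {P : Measure Ω}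
    {z : ℕ → Ω → Z} (hs : IsStationary P z) (j : ℕ) : P.map (z j) = P.map (z 0) := by
  have h := (hs 0 0 j).comp (measurable_pi_apply (0 : Fin 1))
  simpa [Function.comp_def] using h.map_eq.symm

variable {Ω Z : Type*} [MeasurableSpace Ω] [MeasurableSpace Z] {P : Measure Ω}
  [IsProbabilityMeasure P] {z : ℕ → Ω → Z}

theorem abs_sub_le_mixingCoeff {k j : ℕ} {A B : Set Ω} (hA : MeasurableSet[pastField z k] A)
    (hB : MeasurableSet[futureField z (k + j)] B) :
    |P.real (A ∩ B) - P.real A * P.real B| ≤ mixingCoeff P z j := by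
  refine (abs_sub_le_alphaCoeff P hA hB).trans
    (le_ciSup (f := fun k => alphaCoeff P (pastField z k) (futureField z (k + j))) ⟨1, ?_⟩ k)
  rintro _ ⟨k, rfl⟩
  exact alphaCoeff_le_one P

theorem mixingCoeff_nonneg (j : ℕ) : 0 ≤ mixingCoeff P z j :=
  (abs_nonneg _).trans (abs_sub_le_mixingCoeff (z := z) (k := 0)
    (@MeasurableSet.empty _ (pastField z 0)) (@MeasurableSet.empty _ (futureField z (0 + j))))

theorem mixingCoeff_le_one (j : ℕ) : mixingCoeff P z j ≤ 1 :=
  ciSup_le fun _ => alphaCoeff_le_one P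

variable {V : Type*} [NormedAddCommGroup V] [InnerProductSpace ℝ V] [CompleteSpace V]

theorem abs_integral_inner_sub_le_mixingCoeff (hz : ∀ i, Measurable (z i)) {ψ : Z → V}
    (hψ : StronglyMeasurable ψ) {B : ℝ} (hB : ∀ x, ‖ψ x‖ ≤ B) (i l : ℕ) :
    |(∫ ω, inner ℝ (ψ (z i ω)) (ψ (z (i + l) ω)) ∂P) -
      inner ℝ (∫ ω, ψ (z i ω) ∂P) (∫ ω, ψ (z (i + l) ω) ∂P)| ≤ 28 * √(mixingCoeff P z l) * B ^ 2 :=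
  abs_integral_inner_sub_le_sqrt (pastField_le hz i) (futureField_le hz (i + l))
    (fun _ _ hA hB => abs_sub_le_mixingCoeff hA hB)
    (hψ.comp_measurable (measurable_pastField i)) (fun _ => hB _)
    (hψ.comp_measurable (measurable_futureField (i + l))) (fun _ => hB _)

/-- The mean square deviation of a sample mean of a bounded function of a stationary sequence. -/
theorem integral_norm_sq_mean_sub_le (hz : ∀ i, Measurable (z i)) (hs : IsStationary P z)
    {ρ : Measure Z} (hρ : P.map (z 0) = ρ) {ψ : Z → V}
    (hψ : StronglyMeasurable ψ) {B : ℝ} (hB : ∀ x, ‖ψ x‖ ≤ B) {n : ℕ} (hn : 1 ≤ n) :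
    ∫ ω, ‖(1 / (n : ℝ)) • (∑ i : Fin n, ψ (z i ω)) - ∫ x, ψ x ∂ρ‖ ^ 2 ∂P ≤
      1 / (n : ℝ) * (∫ x, ‖ψ x‖ ^ 2 ∂ρ +
        56 * B ^ 2 * ∑ l ∈ Finset.Icc 1 n, √(mixingCoeff P z l)) := by
  have hmap : ∀ i, P.map (z i) = ρ := fun i => (hs.map_eq i).trans hρ
  set m := ∫ x, ψ x ∂ρ with hm
  have hψi : ∀ i, Integrable (fun ω => ψ (z i ω)) P := fun i =>
    Integrable.of_bound (hψ.comp_measurable (hz i)).aestronglyMeasurable B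
      (Eventually.of_forall fun _ => hB _)
  have hψm : ∀ i, ∫ ω, ψ (z i ω) ∂P = m := fun i => by
    rw [hm, ← hmap i, integral_map (hz i).aemeasurable hψ.aestronglyMeasurable]
  have hii : ∀ i j, Integrable (fun ω => inner ℝ (ψ (z i ω)) (ψ (z j ω))) P := fun i j => by
    refine Integrable.of_bound ((hψ.comp_measurable (hz i)).inner
      (hψ.comp_measurable (hz j))).aestronglyMeasurable (B * B)
        (Eventually.of_forall fun ω => (norm_inner_le_norm _ _).trans ?_)
    exact mul_le_mul (hB _) (hB _) (norm_nonneg _) ((norm_nonneg _).trans (hB (z i ω)))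
  set c : ℕ → ℕ → ℝ := fun i j => ∫ ω, inner ℝ (ψ (z i ω) - m) (ψ (z j ω) - m) ∂P with hc
  have hmi : ∀ i, Integrable (fun ω => inner ℝ m (ψ (z i ω))) P := fun i => (hψi i).const_inner m
  have hd : ∀ i j ω, inner ℝ (ψ (z i ω) - m) (ψ (z j ω) - m) = inner ℝ (ψ (z i ω)) (ψ (z j ω)) -
      inner ℝ m (ψ (z i ω)) - inner ℝ m (ψ (z j ω)) + inner ℝ m m := fun i j ω => by
    rw [inner_sub_left, inner_sub_right, inner_sub_right, real_inner_comm m (ψ (z i ω))]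
    ring
  have hci : ∀ i j, Integrable (fun ω => inner ℝ (ψ (z i ω) - m) (ψ (z j ω) - m)) P := by
    intro i j
    simp only [hd]
    exact (((hii i j).sub (hmi i)).sub (hmi j)).add (integrable_const _)
  have hcij : ∀ i j, c i j = (∫ ω, inner ℝ (ψ (z i ω)) (ψ (z j ω)) ∂P) - inner ℝ m m := by
    intro i j
    have i1 : ∀ i, ∫ ω, inner ℝ m (ψ (z i ω)) ∂P = inner ℝ m m := fun i => by
      rw [integral_inner (hψi i), hψm]
    have i2 : Integrable (fun ω => inner ℝ (ψ (z i ω)) (ψ (z j ω)) - inner ℝ m (ψ (z i ω))) P :=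
      (hii i j).sub (hmi i)
    have i3 : Integrable (fun ω => inner ℝ (ψ (z i ω)) (ψ (z j ω)) - inner ℝ m (ψ (z i ω)) -
      inner ℝ m (ψ (z j ω))) P := i2.sub (hmi j)
    simp only [hc, hd]
    rw [integral_add i3 (integrable_const _), integral_sub i2 (hmi j),
      integral_sub (hii i j) (hmi i), i1, i1]
    simp
  set w : ℕ → ℝ := fun l => 28 * √(mixingCoeff P z l) * B ^ 2 with hw
  have hw0 : ∀ l, 0 ≤ w l := fun l => by positivity
  have hlt : ∀ i j, i < j → c i j ≤ w (j - i) := by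
    intro i j hij
    obtain ⟨l, rfl⟩ := Nat.exists_eq_add_of_lt hij
    have h := abs_integral_inner_sub_le_mixingCoeff (P := P) hz hψ hB i (l + 1)
    rw [hψm, hψm, ← add_assoc, ← hcij] at h
    have e : i + l + 1 - i = l + 1 := by omega
    rw [e]
    exact (le_abs_self _).trans h
  have hsymm : ∀ i j, c i j = c j i := fun i j => by
    simp only [hc]
    exact integral_congr_ae (Eventually.of_forall fun ω => real_inner_comm _ _)
  -- The diagonal keeps the second moment instead of B²; this is where the effective dimension will
  -- enter.
  have hdiag : ∀ i, c i i ≤ ∫ x, ‖ψ x‖ ^ 2 ∂ρ := by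
    intro i
    have e : StronglyMeasurable fun x => ‖ψ x‖ ^ 2 := hψ.norm.pow 2
    rw [hcij, ← hmap i, integral_map (hz i).aemeasurable e.aestronglyMeasurable]
    simp only [real_inner_self_eq_norm_sq]
    linarith [sq_nonneg ‖m‖]
  -- In one row each lag occurs at most twice, once on each side of the diagonal, so the constant
  -- becomes 2 · 28 = 56.
  have hrow : ∀ i ∈ Finset.range n, ∑ j ∈ Finset.range n, c i j ≤ (∫ x, ‖ψ x‖ ^ 2 ∂ρ) +
      2 * ∑ l ∈ Finset.Icc 1 n, w l := by
    intro i hi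
    rw [Finset.mem_range] at hi
    have hle : ∀ j ∈ Finset.range n, c i j ≤ (if j = i then ∫ x, ‖ψ x‖ ^ 2 ∂ρ else 0) +
        ((if i < j then w (j - i) else 0) + if j < i then w (i - j) else 0) := by
      intro j _
      rcases lt_trichotomy i j with h | h | h
      · simpa [h, h.ne', h.not_gt] using hlt i j h
      · subst h; simpa using hdiag i
      · rw [hsymm]
        simpa [h, h.ne, h.not_gt] using hlt j i h
    refine (Finset.sum_le_sum hle).trans ?_
    rw [Finset.sum_add_distrib, Finset.sum_add_distrib, Finset.sum_ite_eq', two_mul,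
      if_pos (Finset.mem_range.mpr hi)]
    gcongr
    · rw [← Finset.sum_filter, ← Finset.sum_image (f := w) (g := fun j => j - i)]
      · refine Finset.sum_le_sum_of_subset_of_nonneg (fun l hl => ?_) fun l _ _ => hw0 l
        simp only [Finset.mem_image, Finset.mem_filter, Finset.mem_range] at hl
        obtain ⟨j, hj, rfl⟩ := hl
        rw [Finset.mem_Icc]
        omega
      · intro a ha b hb hab
        simp only [Finset.coe_filter, Finset.mem_range, Set.mem_ofPred_eq] at ha hb
        change a - i = b - i at hab
        omega
    · rw [← Finset.sum_filter, ← Finset.sum_image (f := w) (g := fun j => i - j)]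
      · refine Finset.sum_le_sum_of_subset_of_nonneg (fun l hl => ?_) fun l _ _ => hw0 l
        simp only [Finset.mem_image, Finset.mem_filter, Finset.mem_range] at hl
        obtain ⟨j, hj, rfl⟩ := hl
        rw [Finset.mem_Icc]
        omega
      · intro a ha b hb hab
        simp only [Finset.coe_filter, Finset.mem_range, Set.mem_ofPred_eq] at ha hb
        change i - a = i - b at hab
        omega
  have hn' : (0 : ℝ) < n := by exact_mod_cast hn
  have hexp : ∀ ω, ‖(1 / (n : ℝ)) • (∑ i : Fin n, ψ (z i ω)) - m‖ ^ 2 =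
      (1 / (n : ℝ)) ^ 2 * ∑ i ∈ Finset.range n, ∑ j ∈ Finset.range n,
        inner ℝ (ψ (z i ω) - m) (ψ (z j ω) - m) := by
    intro ω
    have e : (1 / (n : ℝ)) • (∑ i : Fin n, ψ (z i ω)) - m =
        (1 / (n : ℝ)) • ∑ i ∈ Finset.range n, (ψ (z i ω) - m) := by
      rw [Finset.sum_sub_distrib, smul_sub, Finset.sum_range fun i => ψ (z i ω)]
      simp only [Finset.sum_const, Finset.card_range]
      rw [← Nat.cast_smul_eq_nsmul ℝ, smul_smul, one_div_mul_cancel hn'.ne', one_smul]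
    rw [e, norm_smul, mul_pow, ← real_inner_self_eq_norm_sq (∑ i ∈ _, _), sum_inner]
    simp only [inner_sum]
    rw [Real.norm_of_nonneg (by positivity)]
  simp only [hexp]
  rw [integral_const_mul, integral_finsetSum _ fun i _ => integrable_finsetSum _ fun j _ => hci i j]
  have hsum : ∑ i ∈ Finset.range n, ∫ ω, ∑ j ∈ Finset.range n,
      inner ℝ (ψ (z i ω) - m) (ψ (z j ω) - m) ∂P =
      ∑ i ∈ Finset.range n, ∑ j ∈ Finset.range n, c i j :=
    Finset.sum_congr rfl fun i _ => integral_finsetSum _ fun j _ => hci i j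
  rw [hsum]
  have htot := Finset.sum_le_sum hrow
  rw [Finset.sum_const, Finset.card_range, nsmul_eq_mul] at htot
  have hwS : 2 * ∑ l ∈ Finset.Icc 1 n, w l =
      56 * B ^ 2 * ∑ l ∈ Finset.Icc 1 n, √(mixingCoeff P z l) := by
    rw [Finset.mul_sum, Finset.mul_sum]
    exact Finset.sum_congr rfl fun l _ => by rw [hw]; ring
  rw [hwS] at htot
  calc _ ≤ (1 / (n : ℝ)) ^ 2 * _ := mul_le_mul_of_nonneg_left htot (by positivity)
    _ = _ := by field_simp

end Mixing

/-! ### Resolvents of positive operators -/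

section Resolvent

variable {E : Type*} [NormedAddCommGroup E] [InnerProductSpace ℝ E]

theorem mul_norm_le_norm_smul_add {A : E →L[ℝ] E} (hA : ∀ v, 0 ≤ inner ℝ v (A v)) (lam : ℝ) (w : E) :
    lam * ‖w‖ ≤ ‖lam • w + A w‖ := by
  have h1 : lam * ‖w‖ * ‖w‖ ≤ ‖lam • w + A w‖ * ‖w‖ := by
    calc lam * ‖w‖ * ‖w‖ = lam * inner ℝ w w := by rw [real_inner_self_eq_norm_mul_norm]; ring
      _ ≤ inner ℝ w (lam • w + A w) := by
        rw [inner_add_right, inner_smul_right]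
        linarith [hA w]
      _ ≤ ‖w‖ * ‖lam • w + A w‖ := real_inner_le_norm _ _
      _ = _ := mul_comm _ _
  rcases (norm_nonneg w).eq_or_lt with h0 | h0
  · rw [← h0]; simp
  · exact le_of_mul_le_mul_right h1 h0

variable [CompleteSpace E]

theorem isUnit_smul_one_add {A : E →L[ℝ] E} (hA : ∀ v, 0 ≤ inner ℝ v (A v)) {lam : ℝ}
    (hlam : 0 < lam) : IsUnit (lam • (1 : E →L[ℝ] E) + A) := by
  refine ContinuousLinearMap.isUnit_of_forall_le_norm_inner_map _ (c := lam.toNNReal)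
    (Real.toNNReal_pos.mpr hlam) fun x => ?_
  rw [Real.coe_toNNReal _ hlam.le, real_inner_comm]
  refine le_trans ?_ (le_abs_self _)
  simp only [_root_.add_apply, _root_.smul_apply,
    one_apply_eq_self, inner_add_right, inner_smul_right, real_inner_self_eq_norm_sq]
  linarith [hA x]

/-- The resolvent `(lam + A)⁻¹`. -/
def resolvent (A : E →L[ℝ] E) (lam : ℝ) : E →L[ℝ] E :=
  Ring.inverse (lam • (1 : E →L[ℝ] E) + A)

theorem smul_resolvent_add {A : E →L[ℝ] E} (hA : ∀ v, 0 ≤ inner ℝ v (A v)) {lam : ℝ}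
    (hlam : 0 < lam) (v : E) : lam • resolvent A lam v + A (resolvent A lam v) = v := by
  have h := Ring.mul_inverse_cancel _ (isUnit_smul_one_add hA hlam)
  simpa [resolvent] using DFunLike.congr_fun h v

theorem resolvent_smul_add {A : E →L[ℝ] E} (hA : ∀ v, 0 ≤ inner ℝ v (A v)) {lam : ℝ}
    (hlam : 0 < lam) (v : E) : resolvent A lam (lam • v + A v) = v := by
  have h := Ring.inverse_mul_cancel _ (isUnit_smul_one_add hA hlam)
  have h2 := DFunLike.congr_fun h v
  simpa [resolvent] using h2

theorem mul_norm_resolvent_le {A : E →L[ℝ] E} (hA : ∀ v, 0 ≤ inner ℝ v (A v)) {lam : ℝ}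
    (hlam : 0 < lam) (v : E) : lam * ‖resolvent A lam v‖ ≤ ‖v‖ := by
  have h := mul_norm_le_norm_smul_add hA lam (resolvent A lam v)
  rwa [smul_resolvent_add hA hlam] at h

theorem resolvent_comm {A : E →L[ℝ] E} (hA : ∀ v, 0 ≤ inner ℝ v (A v)) {lam : ℝ}
    (hlam : 0 < lam) (v : E) : resolvent A lam (A v) = A (resolvent A lam v) := by
  conv_lhs => rw [← smul_resolvent_add hA hlam v]
  rw [map_add, map_smul, resolvent_smul_add hA hlam]

theorem inner_resolvent_comm {A : E →L[ℝ] E} (hA : ∀ v, 0 ≤ inner ℝ v (A v)) {lam : ℝ}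
    (hlam : 0 < lam) (hs : ∀ u v, inner ℝ (A u) v = inner ℝ u (A v)) (u v : E) :
    inner ℝ (resolvent A lam u) v = inner ℝ u (resolvent A lam v) := by
  conv_lhs => rw [← smul_resolvent_add hA hlam v]
  conv_rhs => rw [← smul_resolvent_add hA hlam u]
  rw [inner_add_left, inner_add_right, inner_smul_left, inner_smul_right, hs]
  rfl

end Resolvent

/-! ### Norms of kernel sections and separability of H -/

section KernelSections

variable {X : Type*} {H : Type*} [NormedAddCommGroup H] [InnerProductSpace ℝ H] [CompleteSpace H]
  [RKHS ℝ H X ℝ] {K : X → X → ℝ}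

theorem norm_kerSection_sq (hH : IsRKHSOf H K) (x : X) : ‖kerSection H x‖ ^ 2 = K x x := by
  rw [← real_inner_self_eq_norm_sq, inner_kerSection, hH]

theorem norm_kerSection_le (hH : IsRKHSOf H K) {κ : ℝ} (hκ : 0 ≤ κ) (hKκ : ∀ x, K x x ≤ κ ^ 2)
    (x : X) : ‖kerSection H x‖ ≤ κ := by
  refine le_of_sq_le_sq ?_ hκ
  rw [norm_kerSection_sq hH]
  exact hKκ x

/-- A continuous function that vanishes on a countable dense set is zero. Hence each basis vector
has a nonzero coefficient against K_x for some x in that set, while each K_x has only countably many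
nonzero coefficients. Countability permits exchanging the trace with an integral. -/
theorem countable_index_hilbertBasis [MetricSpace X] [CompactSpace X] (hK : IsMercerKernel K) (hH : IsRKHSOf H K) {ι : Type*}
    (b : HilbertBasis ι ℝ H) : Countable ι := by
  obtain ⟨D, hDc, hDd⟩ := TopologicalSpace.exists_countable_dense X
  rw [← Set.countable_univ_iff]
  have h1 : (⋃ x ∈ D, Function.support fun i => ‖inner ℝ (b i) (kerSection H x)‖ ^ 2).Countable :=
    hDc.biUnion fun x _ => (b.orthonormal.inner_products_summable (kerSection H x)).countable_support
  refine h1.mono fun i _ => ?_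
  by_contra hi
  simp only [Set.mem_iUnion, Function.mem_support, not_exists, not_not, ne_eq] at hi
  have h2 : ∀ x ∈ D, b i x = 0 := fun x hx => by
    have := hi x hx
    rw [pow_eq_zero_iff two_ne_zero, norm_eq_zero, real_inner_comm, inner_kerSection] at this
    exact this
  have h3 : (b i : X → ℝ) = 0 := by
    refine Continuous.ext_on hDd (continuous_coe hK hH (b i)) continuous_const h2
  have h4 : b i = 0 := RKHS.ext fun x => by rw [h3, RKHS.coe_zero]
  have := b.orthonormal.1 i
  rw [h4] at this
  simp at this

end KernelSections

/-! ### The integral operator and its effective dimension -/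

section IntegralOperatorBounds

variable {X : Type*} [MetricSpace X] [CompactSpace X] [MeasurableSpace X] [BorelSpace X]
  {H : Type*} [NormedAddCommGroup H] [InnerProductSpace ℝ H] [CompleteSpace H] [RKHS ℝ H X ℝ]
  {K : X → X → ℝ} (hK : IsMercerKernel K) (hH : IsRKHSOf H K) (μ : Measure X)
  [IsFiniteMeasure μ]

theorem inner_integralOp (g : H) (φ : Lp ℝ 2 μ) :
    inner ℝ g (integralOp hK hH μ φ) = inner ℝ (toL2 hK hH μ g) φ :=
  inner_integral_smul_kerSection hK hH μ φ g

theorem inner_LKH (g f : H) :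
    inner ℝ g (LKH hK hH μ f) = inner ℝ (toL2 hK hH μ g) (toL2 hK hH μ f) :=
  inner_integralOp hK hH μ g _

theorem LKH_symm (g f : H) : inner ℝ (LKH hK hH μ g) f = inner ℝ g (LKH hK hH μ f) := by
  rw [real_inner_comm, inner_LKH, inner_LKH, real_inner_comm]

theorem LKH_nonneg (f : H) : 0 ≤ inner ℝ f (LKH hK hH μ f) := by
  rw [inner_LKH]; exact real_inner_self_nonneg

theorem inner_toL2_toL2 (g f : H) :
    inner ℝ (toL2 hK hH μ g) (toL2 hK hH μ f) = ∫ x, g x * f x ∂μ := by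
  rw [L2.inner_def]
  refine integral_congr_ae ?_
  filter_upwards [coeFn_toL2 hK hH μ g, coeFn_toL2 hK hH μ f] with x hg hf
  rw [hg, hf]
  simp [mul_comm]

/-- The map `u ↦ (J (lam + T)⁻¹ u, √lam (lam + T)⁻¹ u)`, which satisfies `Φ† Φ = (lam + T)⁻¹`. -/
def resolventFactor (μ : Measure X) [IsFiniteMeasure μ] (lam : ℝ) :
    H →L[ℝ] WithLp 2 (Lp ℝ 2 μ × H) :=
  (WithLp.prodContinuousLinearEquiv 2 ℝ (Lp ℝ 2 μ) H).symm.toContinuousLinearMap ∘L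
    ((toL2 hK hH μ ∘L resolvent (LKH hK hH μ) lam).prod (√lam • resolvent (LKH hK hH μ) lam))

theorem inner_resolventFactor {lam : ℝ} (hlam : 0 < lam) (u v : H) :
    inner ℝ (resolventFactor hK hH μ lam u) (resolventFactor hK hH μ lam v) =
      inner ℝ u (resolvent (LKH hK hH μ) lam v) := by
  have h0 : inner ℝ (resolventFactor hK hH μ lam u) (resolventFactor hK hH μ lam v) =
      inner ℝ (toL2 hK hH μ (resolvent (LKH hK hH μ) lam u))
        (toL2 hK hH μ (resolvent (LKH hK hH μ) lam v)) +
      inner ℝ (√lam • resolvent (LKH hK hH μ) lam u) (√lam • resolvent (LKH hK hH μ) lam v) := by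
    rw [WithLp.prod_inner_apply]
    rfl
  rw [h0, ← inner_LKH, inner_smul_left, inner_smul_right, ← mul_assoc]
  have h1 : (starRingEnd ℝ) √lam * √lam = lam := Real.mul_self_sqrt hlam.le
  rw [h1, ← inner_smul_right, ← inner_add_right, add_comm,
    smul_resolvent_add (LKH_nonneg hK hH μ) hlam,
    inner_resolvent_comm (LKH_nonneg hK hH μ) hlam (LKH_symm hK hH μ)]

theorem norm_resolventFactor_sq {lam : ℝ} (hlam : 0 < lam) (u : H) :
    ‖resolventFactor hK hH μ lam u‖ ^ 2 = inner ℝ u (resolvent (LKH hK hH μ) lam u) := by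
  rw [← real_inner_self_eq_norm_sq, inner_resolventFactor hK hH μ hlam]

theorem mul_norm_resolventFactor_sq_le {lam : ℝ} (hlam : 0 < lam) (u : H) :
    lam * ‖resolventFactor hK hH μ lam u‖ ^ 2 ≤ ‖u‖ ^ 2 := by
  rw [norm_resolventFactor_sq hK hH μ hlam]
  calc lam * inner ℝ u (resolvent (LKH hK hH μ) lam u)
      ≤ lam * (‖u‖ * ‖resolvent (LKH hK hH μ) lam u‖) := by
        gcongr
        exact real_inner_le_norm _ _
    _ = ‖u‖ * (lam * ‖resolvent (LKH hK hH μ) lam u‖) := by ring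
    _ ≤ ‖u‖ * ‖u‖ := by
        gcongr
        exact mul_norm_resolvent_le (LKH_nonneg hK hH μ) hlam u
    _ = ‖u‖ ^ 2 := by ring

theorem sqrt_mul_norm_resolventFactor_le {lam : ℝ} (hlam : 0 < lam) (u : H) :
    √lam * ‖resolventFactor hK hH μ lam u‖ ≤ ‖u‖ := by
  refine le_of_sq_le_sq ?_ (norm_nonneg _)
  rw [mul_pow, Real.sq_sqrt hlam.le]
  exact mul_norm_resolventFactor_sq_le hK hH μ hlam u

/-- With g = Gu, the squared right side is ⟨u, g⟩ = λ‖g‖² + ⟨Tg, g⟩, and T is positive. -/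
theorem sqrt_mul_norm_resolvent_le {lam : ℝ} (hlam : 0 < lam) (u : H) :
    √lam * ‖resolvent (LKH hK hH μ) lam u‖ ≤ ‖resolventFactor hK hH μ lam u‖ := by
  refine le_of_sq_le_sq ?_ (norm_nonneg _)
  rw [mul_pow, Real.sq_sqrt hlam.le, norm_resolventFactor_sq hK hH μ hlam]
  conv_rhs => rw [← smul_resolvent_add (LKH_nonneg hK hH μ) hlam u]
  rw [resolvent_smul_add (LKH_nonneg hK hH μ) hlam, inner_add_left, inner_smul_left,
    real_inner_self_eq_norm_sq, LKH_symm]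
  have := LKH_nonneg hK hH μ (resolvent (LKH hK hH μ) lam u)
  simp only [conj_trivial]
  linarith

/-- The mean of `‖(lam + T)^(-1/2) K_x‖²` is at most the effective dimension. -/
theorem integral_norm_resolventFactor_kerSection_sq_le {lam : ℝ} (hlam : 0 < lam) {C : ℝ} (hC : 0 ≤ C)
    (hN : effectiveDim (LKH hK hH μ) lam ≤ ENNReal.ofReal C) :
    ∫ x, ‖resolventFactor hK hH μ lam (kerSection H x)‖ ^ 2 ∂μ ≤ C := by
  set T := LKH hK hH μ with hT
  set G := resolvent T lam with hG
  have hTn := LKH_nonneg hK hH μ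
  -- This is the basis used in `posTrace`, so independence of the basis is not needed.
  let b := (exists_hilbertBasis ℝ H).choose_spec.choose
  have hcount := countable_index_hilbertBasis hK hH b
  obtain ⟨B, hB0, hB⟩ := exists_bound_kerSection hK hH
  let F : (exists_hilbertBasis ℝ H).choose → X → ℝ := fun i x => b i x * G (b i) x
  have hFi : ∀ i, Integrable (F i) μ := fun i =>
    (memLp_coe hK hH μ (b i)).integrable_mul (memLp_coe hK hH μ (G (b i)))
  have hGb : ∀ i x, G (b i) x = inner ℝ (b i) (G (kerSection H x)) := fun i x => by
    rw [← inner_kerSection, real_inner_comm, inner_resolvent_comm hTn hlam (LKH_symm hK hH μ)]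
  have hb : ∀ i x, b i x = inner ℝ (b i) (kerSection H x) := fun i x => by
    rw [← inner_kerSection, real_inner_comm]
  have hGk : ∀ x, ‖G (kerSection H x)‖ ≤ B / lam := fun x => by
    rw [le_div_iff₀ hlam, mul_comm]
    exact (mul_norm_resolvent_le hTn hlam _).trans (hB x)
  have hsum : Summable fun i => ∫ x, ‖F i x‖ ∂μ := by
    refine summable_of_sum_le (c := ∫ _, (B ^ 2 + (B / lam) ^ 2) / 2 ∂μ)
      (fun i => integral_nonneg fun x => norm_nonneg _) fun s => ?_
    rw [← integral_finsetSum _ fun i _ => (hFi i).norm]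
    refine integral_mono (integrable_finsetSum _ fun i _ => (hFi i).norm) (integrable_const _)
      fun x => ?_
    have h1 : ∀ i ∈ s, ‖F i x‖ ≤ (‖inner ℝ (b i) (kerSection H x)‖ ^ 2 +
        ‖inner ℝ (b i) (G (kerSection H x))‖ ^ 2) / 2 := fun i _ => by
      simp only [F]
      rw [norm_mul, ← hb, ← hGb]
      nlinarith [sq_nonneg (‖b i x‖ - ‖G (b i) x‖)]
    refine (Finset.sum_le_sum h1).trans ?_
    rw [← Finset.sum_div, Finset.sum_add_distrib]
    have h2 := b.orthonormal.sum_inner_products_le (kerSection H x) (s := s)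
    have h3 := b.orthonormal.sum_inner_products_le (G (kerSection H x)) (s := s)
    have h4 : ‖kerSection H x‖ ^ 2 ≤ B ^ 2 := pow_le_pow_left₀ (norm_nonneg _) (hB x) 2
    have h5 : ‖G (kerSection H x)‖ ^ 2 ≤ (B / lam) ^ 2 :=
      pow_le_pow_left₀ (norm_nonneg _) (hGk x) 2
    linarith
  have hs := hasSum_integral_of_summable_integral_norm hFi hsum
  -- Parseval for ⟨K_x, G K_x⟩. Integrated term by term, it becomes the sum of ⟨b_i, G T b_i⟩, which
  -- is the trace.
  have e1 : ∀ x, ∑' i, F i x = ‖resolventFactor hK hH μ lam (kerSection H x)‖ ^ 2 := fun x => by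
    rw [norm_resolventFactor_sq hK hH μ hlam, ← b.tsum_inner_mul_inner]
    refine tsum_congr fun i => ?_
    simp only [F]
    rw [hGb, hb, real_inner_comm]
  simp only [e1] at hs
  have e2 : ∀ i, ∫ x, F i x ∂μ = inner ℝ (b i) (G (T (b i))) := fun i => by
    rw [resolvent_comm hTn hlam, inner_LKH, inner_toL2_toL2]
  -- With u = G b_i the term is ⟨λu + Tu, Tu⟩ = λ⟨u, Tu⟩ + ‖Tu‖².
  have h0 : ∀ i, 0 ≤ inner ℝ (b i) (G (T (b i))) := fun i => by
    have hbi := smul_resolvent_add hTn hlam (b i)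
    rw [resolvent_comm hTn hlam]
    conv_rhs => rw [← hbi]
    rw [inner_add_left, inner_smul_left]
    rw [hbi]
    exact add_nonneg (mul_nonneg hlam.le (hTn _)) real_inner_self_nonneg
  simp only [e2] at hs
  have h3 : ENNReal.ofReal (∑' i, inner ℝ (b i) (G (T (b i)))) ≤ ENNReal.ofReal C := by
    rw [ENNReal.ofReal_tsum_of_nonneg h0 hs.summable]
    exact hN
  rw [← hs.tsum_eq]
  exact (ENNReal.ofReal_le_ofReal_iff hC).mp h3

end IntegralOperatorBounds

/-! ### The source condition -/

section OrthogonalSums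

variable {E : Type*} [NormedAddCommGroup E] [InnerProductSpace ℝ E]

theorem norm_sum_sq_of_orthogonal {ι : Type*} {u : ι → E}
    (hu : ∀ i j, i ≠ j → inner ℝ (u i) (u j) = 0) (s : Finset ι) :
    ‖∑ i ∈ s, u i‖ ^ 2 = ∑ i ∈ s, ‖u i‖ ^ 2 := by
  classical
  rw [← real_inner_self_eq_norm_sq, sum_inner]
  refine Finset.sum_congr rfl fun i hi => ?_
  rw [inner_sum, Finset.sum_eq_single i (fun j _ hj => hu i j hj.symm) fun h => absurd hi h,
    real_inner_self_eq_norm_sq]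

theorem summable_and_norm_tsum_sq_le_of_orthogonal [CompleteSpace E] {ι : Type*} {u : ι → E}
    (hu : ∀ i j, i ≠ j → inner ℝ (u i) (u j) = 0) {c : ℝ}
    (hc : ∀ s : Finset ι, ∑ i ∈ s, ‖u i‖ ^ 2 ≤ c) : Summable u ∧ ‖∑' i, u i‖ ^ 2 ≤ c := by
  have h1 : OrthogonalFamily ℝ (fun i => Submodule.span ℝ {u i})
      fun i => (Submodule.span ℝ {u i}).subtypeₗᵢ := by
    intro i j hij v w
    obtain ⟨a, ha⟩ := Submodule.mem_span_singleton.mp v.2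
    obtain ⟨b, hb⟩ := Submodule.mem_span_singleton.mp w.2
    change inner ℝ (v : E) (w : E) = 0
    rw [← ha, ← hb, inner_smul_left, inner_smul_right, hu i j hij]
    simp
  have h2 := h1.summable_iff_norm_sq_summable fun i => ⟨u i, Submodule.mem_span_singleton_self _⟩
  have h3 : Summable u :=
    h2.mpr (summable_of_sum_le (fun i => sq_nonneg _) hc)
  refine ⟨h3, le_of_tendsto (h3.hasSum.norm.pow 2) (Eventually.of_forall fun s => ?_)⟩
  rw [norm_sum_sq_of_orthogonal hu]
  exact hc s

end OrthogonalSums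

/-! ### Least-norm version and bias under the source condition -/

section SourceCondition

variable {X : Type*} [MetricSpace X] [CompactSpace X] [MeasurableSpace X] [BorelSpace X]
  {H : Type*} [NormedAddCommGroup H] [InnerProductSpace ℝ H] [CompleteSpace H] [RKHS ℝ H X ℝ]
  {K : X → X → ℝ} (hK : IsMercerKernel K) (hH : IsRKHSOf H K) (μ : Measure X)
  [IsFiniteMeasure μ]

theorem norm_toL2_le [IsProbabilityMeasure μ] {κ : ℝ} (hκ : 0 ≤ κ)
    (hKκ : ∀ x, K x x ≤ κ ^ 2) (f : H) : ‖toL2 hK hH μ f‖ ≤ κ * ‖f‖ := by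
  have h := Lp.norm_le_of_ae_bound (p := 2) (μ := μ) (f := toL2 hK hH μ f) (C := κ * ‖f‖)
    (by positivity) (by
      filter_upwards [coeFn_toL2 hK hH μ f] with x hx
      rw [hx, ← inner_kerSection]
      exact (norm_inner_le_norm _ _).trans
        (mul_le_mul_of_nonneg_right (norm_kerSection_le hH hκ hKκ x) (norm_nonneg _)))
  have h1 : measureUnivNNReal μ = 1 := by simp [measureUnivNNReal]
  simpa [h1] using h

theorem inner_integralOp_integralOp (φ χ : Lp ℝ 2 μ) :
    inner ℝ (integralOp hK hH μ φ) (integralOp hK hH μ χ) = inner ℝ (LK2 hK hH μ φ) χ :=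
  inner_integralOp hK hH μ _ χ

theorem norm_integralOp_le [IsProbabilityMeasure μ] {κ : ℝ} (hκ : 0 ≤ κ)
    (hKκ : ∀ x, K x x ≤ κ ^ 2) (φ : Lp ℝ 2 μ) : ‖integralOp hK hH μ φ‖ ≤ κ * ‖φ‖ := by
  set v := integralOp hK hH μ φ with hv
  have h1 : ‖v‖ * ‖v‖ ≤ κ * ‖φ‖ * ‖v‖ := by
    rw [← real_inner_self_eq_norm_mul_norm]
    nth_rewrite 2 [hv]
    rw [inner_integralOp]
    calc inner ℝ (toL2 hK hH μ v) φ ≤ ‖toL2 hK hH μ v‖ * ‖φ‖ := real_inner_le_norm _ _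
      _ ≤ κ * ‖v‖ * ‖φ‖ := by
        gcongr
        exact norm_toL2_le hK hH μ hκ hKκ v
      _ = _ := by ring
  rcases (norm_nonneg v).eq_or_lt with h0 | h0
  · rw [← h0]; positivity
  · exact le_of_mul_le_mul_right h1 h0

theorem rpow_le_one_add {t θ : ℝ} (ht : 0 ≤ t) (h0 : 0 ≤ θ) (h1 : θ ≤ 1) : t ^ θ ≤ 1 + t := by
  rcases le_total t 1 with h | h
  · linarith [Real.rpow_le_one ht h h0]
  · have := Real.rpow_le_rpow_of_exponent_le h h1
    rw [Real.rpow_one] at this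
    linarith

/-- Under the source condition `φ = L_K ^ r h` the class `φ` has a version of least norm in `H`, of
bounded norm, and the bias of the regularization is of order `lam ^ (r - 1 / 2)`. -/
theorem exists_version_of_isPowApply [IsProbabilityMeasure μ] {κ r : ℝ} (hκ : 0 ≤ κ)
    (hKκ : ∀ x, K x x ≤ κ ^ 2) (hr : 1 / 2 ≤ r) (hr' : r ≤ 1) {h φ : Lp ℝ 2 μ}
    (hφ : IsPowApply (LK2 hK hH μ) r h φ) :
    ∃ f : H, toL2 hK hH μ f = φ ∧ (∀ g : H, toL2 hK hH μ g = φ → ‖f‖ ≤ ‖g‖) ∧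
      ‖f‖ ^ 2 ≤ (1 + κ ^ 2) * ‖h‖ ^ 2 ∧
      ∀ lam : ℝ, 0 < lam →
        lam * ‖resolvent (LKH hK hH μ) lam f‖ ≤ lam ^ (r - 1 / 2) * ‖h‖ := by
  set J := toL2 hK hH μ with hJ
  set S := integralOp hK hH μ with hS
  set T₂ := LK2 hK hH μ with hT₂
  set T := LKH hK hH μ with hT
  have hTn := LKH_nonneg hK hH μ
  have hJS : ∀ u, J (S u) = T₂ u := fun u => rfl
  have hSJ : ∀ u, S (J u) = T u := fun u => rfl
  have hJSi : ∀ g u, inner ℝ g (S u) = inner ℝ (J g) u := inner_integralOp hK hH μ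
  have hSS : ∀ u v, inner ℝ (S u) (S v) = inner ℝ (T₂ u) v := inner_integralOp_integralOp hK hH μ
  let p : ℝ → Lp ℝ 2 μ := fun σ =>
    (T₂ - σ • ContinuousLinearMap.id ℝ (Lp ℝ 2 μ)).ker.starProjection h
  have hp : ∀ σ, T₂ (p σ) = σ • p σ := fun σ => by
    have h1 : p σ ∈ (T₂ - σ • ContinuousLinearMap.id ℝ (Lp ℝ 2 μ)).ker :=
      Submodule.starProjection_apply_mem _ h
    have h2 : (T₂ - σ • ContinuousLinearMap.id ℝ (Lp ℝ 2 μ)) (p σ) = 0 := h1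
    exact sub_eq_zero.mp h2
  have hSp : ∀ σ τ, inner ℝ (S (p σ)) (S (p τ)) = σ * inner ℝ (p σ) (p τ) := fun σ τ => by
    rw [hSS, hp, inner_smul_left]; rfl
  have horth : ∀ σ τ, σ ≠ τ → inner ℝ (p σ) (p τ) = 0 := fun σ τ hστ => by
    have h1 := hSp σ τ
    rw [real_inner_comm, hSp τ σ, real_inner_comm (p σ) (p τ)] at h1
    have h2 : (σ - τ) * inner ℝ (p σ) (p τ) = 0 := by linarith
    exact (mul_eq_zero.mp h2).resolve_left (sub_ne_zero.mpr hστ)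
  have hSn : ∀ σ, ‖S (p σ)‖ ^ 2 = σ * ‖p σ‖ ^ 2 := fun σ => by
    rw [← real_inner_self_eq_norm_sq, hSp, real_inner_self_eq_norm_sq]
  have hneg : ∀ σ, σ < 0 → p σ = 0 := fun σ hσ => by
    have h1 := sq_nonneg ‖S (p σ)‖
    rw [hSn] at h1
    have h2 : ‖p σ‖ ^ 2 = 0 := le_antisymm (by nlinarith [sq_nonneg ‖p σ‖]) (sq_nonneg _)
    simpa using h2
  have hbessel : ∀ s : Finset ℝ, ∑ σ ∈ s, ‖p σ‖ ^ 2 ≤ ‖h‖ ^ 2 := fun s => by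
    have h1 := norm_sum_sq_of_orthogonal horth s
    have h2 : ∑ σ ∈ s, ‖p σ‖ ^ 2 = inner ℝ (∑ σ ∈ s, p σ) h := by
      rw [sum_inner]
      refine Finset.sum_congr rfl fun σ _ => ?_
      rw [← real_inner_self_eq_norm_sq]
      simp only [p]
      rw [Submodule.inner_starProjection_left_eq_right,
        Submodule.starProjection_eq_self_iff.mpr (Submodule.starProjection_apply_mem _ h),
        Submodule.inner_starProjection_left_eq_right]
    have h3 := real_inner_le_norm (∑ σ ∈ s, p σ) h
    rw [← h2, ← h1] at h3
    have h4 : ‖∑ σ ∈ s, p σ‖ ≤ ‖h‖ := by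
      rcases (norm_nonneg (∑ σ ∈ s, p σ)).eq_or_lt with h0 | h0
      · rw [← h0]; exact norm_nonneg _
      · refine le_of_mul_le_mul_left ?_ h0
        rwa [← pow_two]
    rw [← h1]
    exact pow_le_pow_left₀ (norm_nonneg _) h4 2
  -- Since J S p_σ = σ p_σ, the sum of the F σ is mapped by J to ∑ σ^r p_σ = φ. The identity ‖S
  -- p_σ‖² = σ ‖p_σ‖² gives ‖F σ‖² = σ^(2r-1) ‖p_σ‖² for σ > 0, which is summable because 0 ≤ 2r - 1
  -- ≤ 1 and the relevant σ are at most κ².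
  let F : ℝ → H := fun σ => σ ^ (r - 1) • S (p σ)
  have hF0 : ∀ σ, σ ≤ 0 → F σ = 0 := fun σ hσ => by
    rcases hσ.eq_or_lt with h0 | h0
    · have h1 := hSn σ
      rw [h0, zero_mul] at h1
      have h2 : S (p 0) = 0 := by simpa using h1
      simp only [F]
      rw [h0, h2, smul_zero]
    · simp [F, hneg σ h0]
  have hFn : ∀ σ, 0 < σ → ‖F σ‖ ^ 2 = σ ^ (2 * r - 1) * ‖p σ‖ ^ 2 := fun σ hσ => by
    simp only [F]
    rw [norm_smul, mul_pow, hSn, Real.norm_of_nonneg (Real.rpow_nonneg hσ.le _), ← mul_assoc,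
      ← Real.rpow_natCast, ← Real.rpow_mul hσ.le, ← Real.rpow_add_one hσ.ne']
    congr 2
    push_cast
    ring
  have hForth : ∀ σ τ, σ ≠ τ → inner ℝ (F σ) (F τ) = 0 := fun σ τ hστ => by
    simp only [F]
    rw [inner_smul_left, inner_smul_right, hSp, horth σ τ hστ]
    simp
  have hσκ : ∀ σ, σ * ‖p σ‖ ^ 2 ≤ κ ^ 2 * ‖p σ‖ ^ 2 := fun σ => by
    rw [← hSn, ← mul_pow]
    exact pow_le_pow_left₀ (norm_nonneg _) (norm_integralOp_le hK hH μ hκ hKκ _) 2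
  have hF1 : ∀ σ, ‖F σ‖ ^ 2 ≤ (1 + κ ^ 2) * ‖p σ‖ ^ 2 := fun σ => by
    rcases le_or_gt σ 0 with h0 | h0
    · rw [hF0 σ h0, norm_zero, zero_pow two_ne_zero]; positivity
    · rw [hFn σ h0]
      calc σ ^ (2 * r - 1) * ‖p σ‖ ^ 2 ≤ (1 + σ) * ‖p σ‖ ^ 2 := by
            gcongr
            exact rpow_le_one_add h0.le (by linarith) (by linarith)
        _ ≤ _ := by linarith [hσκ σ]
  obtain ⟨hFs, hFb⟩ := summable_and_norm_tsum_sq_le_of_orthogonal hForth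
    (c := (1 + κ ^ 2) * ‖h‖ ^ 2) fun s => by
      refine (Finset.sum_le_sum fun σ _ => hF1 σ).trans ?_
      rw [← Finset.mul_sum]
      exact mul_le_mul_of_nonneg_left (hbessel s) (by positivity)
  have hJF : J (∑' σ, F σ) = φ := by
    refine (J.hasSum hFs.hasSum).unique ?_
    have e : (fun σ => J (F σ)) = fun σ => σ ^ r • p σ := by
      funext σ
      simp only [F]
      rw [map_smul, hJS, hp, smul_smul]
      rcases lt_trichotomy σ 0 with h0 | h0 | h0
      · rw [hneg σ h0, smul_zero, smul_zero]
      · rw [h0, mul_zero, Real.zero_rpow (by linarith)]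
      · rw [← Real.rpow_add_one h0.ne', sub_add_cancel]
    change HasSum (fun σ => J (F σ)) φ
    rw [e]
    exact hφ
  refine ⟨∑' σ, F σ, hJF, fun g hg => ?_, hFb, fun lam hlam => ?_⟩
  · set f := ∑' σ, F σ with hf
    -- Each F σ is in the range of S, the adjoint of J, hence orthogonal to ker J, which contains g
    -- - f. Minimality is then Pythagoras.
    have h1 : inner ℝ (g - f) f = 0 := by
      have h2 := (innerSL ℝ (g - f)).hasSum hFs.hasSum
      refine h2.unique ?_
      have e : (fun σ => innerSL ℝ (g - f) (F σ)) = fun _ => 0 := by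
        funext σ
        simp only [innerSL_apply_apply, F]
        rw [inner_smul_right, hJSi, map_sub, hg, hJF, sub_self, inner_zero_left, mul_zero]
      change HasSum (fun σ => innerSL ℝ (g - f) (F σ)) 0
      rw [e]
      exact hasSum_zero
    have h3 : ‖g‖ ^ 2 = ‖g - f‖ ^ 2 + ‖f‖ ^ 2 := by
      have := norm_add_sq_real (g - f) f
      rw [sub_add_cancel, h1] at this
      linarith
    refine le_of_sq_le_sq ?_ (norm_nonneg _)
    rw [h3]
    linarith [sq_nonneg ‖g - f‖]
  · set G := resolvent T lam with hG
    have hGF : ∀ σ, (lam + σ) • G (F σ) = F σ := fun σ => by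
      have h1 : T (F σ) = σ • F σ := by
        simp only [F]
        rw [map_smul, ← hSJ, hJS, hp, map_smul, smul_comm]
      have h2 := resolvent_smul_add hTn hlam (F σ)
      rw [h1, ← add_smul, map_smul] at h2
      exact h2
    have hGn : ∀ σ, ‖lam • G (F σ)‖ ^ 2 ≤ lam ^ (2 * r - 1) * ‖p σ‖ ^ 2 := fun σ => by
      rcases le_or_gt σ 0 with h0 | h0
      · rw [hF0 σ h0, map_zero, smul_zero, norm_zero, zero_pow two_ne_zero]; positivity
      · have hls : 0 < lam + σ := by linarith
        have h1 : (lam + σ) ^ 2 * ‖G (F σ)‖ ^ 2 = σ ^ (2 * r - 1) * ‖p σ‖ ^ 2 := by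
          rw [← hFn σ h0, ← hGF σ, norm_smul, mul_pow, Real.norm_of_nonneg hls.le]
          congr 3
          exact (hGF σ).symm ▸ rfl
        -- On F σ the operator λG acts as λ/(λ + σ). After division by powers of λ the claim reads
        -- (σ/λ)^(2r-1) ≤ (1 + σ/λ)².
        have h2 : lam ^ 2 * σ ^ (2 * r - 1) ≤ lam ^ (2 * r - 1) * (lam + σ) ^ 2 := by
          have h3 : (σ / lam) ^ (2 * r - 1) ≤ 1 + σ / lam :=
            rpow_le_one_add (by positivity) (by linarith) (by linarith)
          have h4 : σ ^ (2 * r - 1) = lam ^ (2 * r - 1) * (σ / lam) ^ (2 * r - 1) := by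
            rw [← Real.mul_rpow hlam.le (by positivity), mul_div_cancel₀ _ hlam.ne']
          have h5 : lam ^ 2 * (1 + σ / lam) ≤ (lam + σ) ^ 2 := by
            have : lam ^ 2 * (1 + σ / lam) = lam ^ 2 + lam * σ := by field_simp
            rw [this]
            nlinarith [mul_pos hlam h0, sq_nonneg σ]
          rw [h4]
          calc lam ^ 2 * (lam ^ (2 * r - 1) * (σ / lam) ^ (2 * r - 1))
              ≤ lam ^ 2 * (lam ^ (2 * r - 1) * (1 + σ / lam)) := by gcongr
            _ = lam ^ (2 * r - 1) * (lam ^ 2 * (1 + σ / lam)) := by ring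
            _ ≤ _ := by gcongr
        rw [norm_smul, mul_pow, Real.norm_of_nonneg hlam.le]
        refine le_of_mul_le_mul_left ?_ (pow_pos hls 2)
        calc (lam + σ) ^ 2 * (lam ^ 2 * ‖G (F σ)‖ ^ 2)
            = lam ^ 2 * ((lam + σ) ^ 2 * ‖G (F σ)‖ ^ 2) := by ring
          _ = lam ^ 2 * σ ^ (2 * r - 1) * ‖p σ‖ ^ 2 := by rw [h1]; ring
          _ ≤ lam ^ (2 * r - 1) * (lam + σ) ^ 2 * ‖p σ‖ ^ 2 := by gcongr
          _ = _ := by ring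
    have hGorth : ∀ σ τ, σ ≠ τ → inner ℝ (lam • G (F σ)) (lam • G (F τ)) = 0 := by
      intro σ τ hστ
      rcases le_or_gt σ 0 with h0 | h0
      · rw [hF0 σ h0]; simp
      rcases le_or_gt τ 0 with h0' | h0'
      · rw [hF0 τ h0']; simp
      have h1 := hForth σ τ hστ
      rw [← hGF σ, ← hGF τ, inner_smul_left, inner_smul_right] at h1
      have h2 : inner ℝ (G (F σ)) (G (F τ)) = 0 := by
        have a1 : lam + σ ≠ 0 := by positivity
        have a2 : lam + τ ≠ 0 := by positivity
        simpa [a1, a2] using h1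
      rw [inner_smul_left, inner_smul_right, h2]
      simp
    obtain ⟨-, hb⟩ := summable_and_norm_tsum_sq_le_of_orthogonal hGorth
      (c := lam ^ (2 * r - 1) * ‖h‖ ^ 2) fun s => by
        refine (Finset.sum_le_sum fun σ _ => hGn σ).trans ?_
        rw [← Finset.mul_sum]
        exact mul_le_mul_of_nonneg_left (hbessel s) (by positivity)
    have e : ∑' σ, lam • G (F σ) = lam • G (∑' σ, F σ) := by
      have := (lam • G).hasSum hFs.hasSum
      exact this.tsum_eq
    rw [e, norm_smul, Real.norm_of_nonneg hlam.le] at hb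
    refine le_of_sq_le_sq ?_ (by positivity)
    refine hb.trans_eq ?_
    rw [mul_pow, ← Real.rpow_natCast (lam ^ (r - 1 / 2)), ← Real.rpow_mul hlam.le]
    congr 2
    push_cast
    ring

end SourceCondition

/-! ### The estimator and its error -/

section Estimator

variable {X : Type*} {H : Type*} [NormedAddCommGroup H] [InnerProductSpace ℝ H] [CompleteSpace H]
  [RKHS ℝ H X ℝ]

variable (H) in
/-- The empirical integral operator `v ↦ (1 / n) ∑ v(x_i) K_{x_i}`. -/
def empOp {n : ℕ} (D : Fin n → X × ℝ) : H →L[ℝ] H :=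
  (1 / (n : ℝ)) • ∑ i, (innerSL ℝ (kerSection H (D i).1)).smulRight (kerSection H (D i).1)

variable (H) in
/-- The empirical target `(1 / n) ∑ y_i K_{x_i}`. -/
def empTarget {n : ℕ} (D : Fin n → X × ℝ) : H :=
  (1 / (n : ℝ)) • ∑ i, (D i).2 • kerSection H (D i).1

theorem empOp_apply {n : ℕ} (D : Fin n → X × ℝ) (v : H) :
    empOp H D v = (1 / (n : ℝ)) • ∑ i, v (D i).1 • kerSection H (D i).1 := by
  simp [empOp, inner_kerSection]

theorem inner_empOp {n : ℕ} (D : Fin n → X × ℝ) (u v : H) :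
    inner ℝ u (empOp H D v) = (1 / (n : ℝ)) * ∑ i, u (D i).1 * v (D i).1 := by
  rw [empOp_apply, inner_smul_right, inner_sum]
  congr 1
  refine Finset.sum_congr rfl fun i _ => ?_
  rw [inner_smul_right, real_inner_comm, inner_kerSection, mul_comm]

theorem inner_empTarget {n : ℕ} (D : Fin n → X × ℝ) (u : H) :
    inner ℝ u (empTarget H D) = (1 / (n : ℝ)) * ∑ i, u (D i).1 * (D i).2 := by
  rw [empTarget, inner_smul_right, inner_sum]
  congr 1
  refine Finset.sum_congr rfl fun i _ => ?_
  rw [inner_smul_right, real_inner_comm, inner_kerSection, mul_comm]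

theorem empOp_nonneg {n : ℕ} (D : Fin n → X × ℝ) (v : H) : 0 ≤ inner ℝ v (empOp H D v) := by
  rw [inner_empOp]
  exact mul_nonneg (by positivity) (Finset.sum_nonneg fun i _ => mul_self_nonneg _)

/-- The closed form of the kernel ridge regression estimator. -/
theorem krr_eq_resolvent {n : ℕ} (D : Fin n → X × ℝ) {lam : ℝ} (hlam : 0 < lam) :
    krr H D lam = resolvent (empOp H D) lam (empTarget H D) := by
  set f := resolvent (empOp H D) lam (empTarget H D) with hf
  have hN : lam • f + empOp H D f = empTarget H D :=
    smul_resolvent_add (empOp_nonneg D) hlam _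
  have hmin : ∀ g : H, ridgeRisk D lam f ≤ ridgeRisk D lam g := by
    intro g
    obtain ⟨d, rfl⟩ : ∃ d, g = f + d := ⟨g - f, by abel⟩
    have h1 : lam * inner ℝ f d + (1 / (n : ℝ)) * ∑ i, f (D i).1 * d (D i).1 =
        (1 / (n : ℝ)) * ∑ i, (D i).2 * d (D i).1 := by
      have h2 := congrArg (inner ℝ d) hN
      rw [inner_add_right, inner_smul_right, inner_empOp, inner_empTarget, real_inner_comm] at h2
      simp only [mul_comm (d _)] at h2
      exact h2
    have h2 : 0 ≤ (1 / (n : ℝ)) * ∑ i, d (D i).1 ^ 2 :=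
      mul_nonneg (by positivity) (Finset.sum_nonneg fun i _ => sq_nonneg _)
    have h3 : ∑ i, ((f + d) (D i).1 - (D i).2) ^ 2 = ∑ i, (f (D i).1 - (D i).2) ^ 2 +
        2 * ∑ i, f (D i).1 * d (D i).1 - 2 * ∑ i, (D i).2 * d (D i).1 + ∑ i, d (D i).1 ^ 2 := by
      rw [Finset.mul_sum, Finset.mul_sum, ← Finset.sum_add_distrib, ← Finset.sum_sub_distrib,
        ← Finset.sum_add_distrib]
      refine Finset.sum_congr rfl fun i _ => ?_
      rw [RKHS.coe_add, Pi.add_apply]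
      ring
    have h4 : 0 ≤ lam * ‖d‖ ^ 2 := by positivity
    unfold ridgeRisk
    rw [h3, norm_add_sq_real]
    linarith
  exact (existsUnique_minimizer D hlam).unique
    (Classical.epsilon_spec (existsUnique_minimizer D hlam).exists) hmin

/-- Inversion is continuous at units. This provides the measurability of the error as a function of
the sample. -/
theorem continuous_krr [TopologicalSpace X] {K : X → X → ℝ} (hK : IsMercerKernel K)
    (hH : IsRKHSOf H K) (n : ℕ) {lam : ℝ} (hlam : 0 < lam) :
    Continuous fun D : Fin n → X × ℝ => krr H D lam := by
  have hk : ∀ i, Continuous fun D : Fin n → X × ℝ => kerSection H (D i).1 := fun i =>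
    (continuous_kerSection hK hH).comp (continuous_fst.comp (continuous_apply i))
  have h1 : Continuous fun D : Fin n → X × ℝ => empTarget H D := by
    unfold empTarget
    have h3 : Continuous fun D : Fin n → X × ℝ => ∑ i, (D i).2 • kerSection H (D i).1 :=
      continuous_finsetSum _ fun i _ =>
        (continuous_snd.comp (continuous_apply i)).smul (hk i)
    exact h3.const_smul _
  have h2 : Continuous fun D : Fin n → X × ℝ => empOp H D := by
    unfold empOp
    have h3 : ∀ i, Continuous fun D : Fin n → X × ℝ => innerSL ℝ (kerSection H (D i).1) :=
      fun i => (innerSL ℝ).continuous.comp (hk i)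
    have h4 : Continuous fun D : Fin n → X × ℝ => ∑ i,
        (innerSL ℝ (kerSection H (D i).1)).smulRight (kerSection H (D i).1) :=
      continuous_finsetSum _ fun i _ =>
        (ContinuousLinearMap.smulRightL ℝ H H).continuous₂.comp ((h3 i).prodMk (hk i))
    exact h4.const_smul (1 / (n : ℝ))
  have h4 : Continuous fun D : Fin n → X × ℝ => resolvent (empOp H D) lam := by
    rw [continuous_iff_continuousAt]
    intro D
    obtain ⟨u, hu⟩ := isUnit_smul_one_add (empOp_nonneg (H := H) D) hlam
    have h5 := NormedRing.inverse_continuousAt u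
    rw [hu] at h5
    exact ContinuousAt.comp
      (f := fun D : Fin n → X × ℝ => lam • (1 : H →L[ℝ] H) + empOp H D) h5
      (continuous_const.add h2).continuousAt
  have h6 : (fun D : Fin n → X × ℝ => krr H D lam) =
      fun D => resolvent (empOp H D) lam (empTarget H D) :=
    funext fun D => krr_eq_resolvent D hlam
  rw [h6]
  exact h4.clm_apply h1

end Estimator

/-! ### Second-order error decomposition and Hilbert tensors -/

section ErrorDecomposition

open scoped TensorProduct

variable {X : Type*} [MetricSpace X] [CompactSpace X] [MeasurableSpace X] [BorelSpace X]
  {H : Type*} [NormedAddCommGroup H] [InnerProductSpace ℝ H] [CompleteSpace H] [RKHS ℝ H X ℝ]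
  {K : X → X → ℝ} (hK : IsMercerKernel K) (hH : IsRKHSOf H K) (μ : Measure X)
  [IsFiniteMeasure μ]

/-- The Hilbert tensor `K_x ⊗ Φ K_x`, which represents the rank one operator
`v ↦ ⟪Φ K_x, v⟫ K_x`, where `Φ` is `resolventFactor`. -/
def tensorSection (lam : ℝ) (x : X) :
    UniformSpace.Completion (H ⊗[ℝ] WithLp 2 (Lp ℝ 2 μ × H)) :=
  ((kerSection H x ⊗ₜ[ℝ] resolventFactor hK hH μ lam (kerSection H x) :
    H ⊗[ℝ] WithLp 2 (Lp ℝ 2 μ × H)) : UniformSpace.Completion _)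

theorem norm_tensorSection (lam : ℝ) (x : X) : ‖tensorSection hK hH μ lam x‖ =
    ‖kerSection H x‖ * ‖resolventFactor hK hH μ lam (kerSection H x)‖ := by
  rw [tensorSection, UniformSpace.Completion.norm_coe, TensorProduct.norm_tmul]

theorem continuous_tensorSection (lam : ℝ) : Continuous (tensorSection hK hH μ lam) := by
  have hk := continuous_kerSection hK hH
  exact (UniformSpace.Completion.continuous_coe _).comp (TensorProduct.continuous_tmul.comp
    (hk.prodMk ((resolventFactor hK hH μ lam).continuous.comp hk)))

theorem integrable_tensorSection (lam : ℝ) : Integrable (tensorSection hK hH μ lam) μ := by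
  obtain ⟨C, hC⟩ := isCompact_univ.exists_bound_of_continuousOn
    (continuous_tensorSection hK hH μ lam).continuousOn
  exact Integrable.of_bound (continuous_tensorSection hK hH μ lam).aestronglyMeasurable C
    (Eventually.of_forall fun x => hC x trivial)

theorem inner_tmul_tensorSection {lam : ℝ} (hlam : 0 < lam) (w v : H) (x : X) :
    inner ℝ (((w ⊗ₜ[ℝ] resolventFactor hK hH μ lam v : H ⊗[ℝ] WithLp 2 (Lp ℝ 2 μ × H)) :
      UniformSpace.Completion _)) (tensorSection hK hH μ lam x) =
      w x * resolvent (LKH hK hH μ) lam v x := by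
  rw [tensorSection, UniformSpace.Completion.inner_coe, TensorProduct.inner_tmul,
    inner_resolventFactor hK hH μ hlam,
    ← inner_resolvent_comm (LKH_nonneg hK hH μ) hlam (LKH_symm hK hH μ),
    real_inner_comm, inner_kerSection, real_inner_comm, inner_kerSection]

/-- The deviation of the empirical integral operator, applied to a resolvent, is controlled by
the deviation of the mean of `tensorSection`. -/
theorem norm_empOp_sub_LKH_resolvent_le {lam : ℝ} (hlam : 0 < lam) {n : ℕ} (D : Fin n → X × ℝ)
    (v : H) :
    ‖empOp H D (resolvent (LKH hK hH μ) lam v) - LKH hK hH μ (resolvent (LKH hK hH μ) lam v)‖ ≤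
      ‖(1 / (n : ℝ)) • (∑ i, tensorSection hK hH μ lam (D i).1) -
        ∫ x, tensorSection hK hH μ lam x ∂μ‖ * ‖resolventFactor hK hH μ lam v‖ := by
  set w := empOp H D (resolvent (LKH hK hH μ) lam v) -
    LKH hK hH μ (resolvent (LKH hK hH μ) lam v) with hw
  set Ξ := (1 / (n : ℝ)) • (∑ i, tensorSection hK hH μ lam (D i).1) -
    ∫ x, tensorSection hK hH μ lam x ∂μ with hΞ
  let t : UniformSpace.Completion (H ⊗[ℝ] WithLp 2 (Lp ℝ 2 μ × H)) :=
    ((w ⊗ₜ[ℝ] resolventFactor hK hH μ lam v : H ⊗[ℝ] WithLp 2 (Lp ℝ 2 μ × H)) :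
      UniformSpace.Completion _)
  have ht : ‖t‖ = ‖w‖ * ‖resolventFactor hK hH μ lam v‖ := by
    simp only [t]
    rw [UniformSpace.Completion.norm_coe, TensorProduct.norm_tmul]
  -- Because Φ†Φ = G, testing Ξ against w ⊗ Φv gives ⟨w, (T_D - T)Gv⟩, which is ‖w‖² for this w.
  -- Cauchy–Schwarz concludes.
  have h1 : inner ℝ t Ξ = inner ℝ w w := by
    nth_rewrite 2 [hw]
    rw [hΞ, inner_sub_right, inner_sub_right, inner_smul_right, inner_sum,
      ← integral_inner (integrable_tensorSection hK hH μ lam), inner_empOp, inner_LKH,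
      inner_toL2_toL2]
    simp only [t, inner_tmul_tensorSection hK hH μ hlam]
  have h2 : ‖w‖ * ‖w‖ ≤ ‖w‖ * (‖Ξ‖ * ‖resolventFactor hK hH μ lam v‖) := by
    rw [← real_inner_self_eq_norm_mul_norm, ← h1]
    refine (real_inner_le_norm _ _).trans_eq ?_
    rw [ht]
    ring
  rcases (norm_nonneg w).eq_or_lt with h0 | h0
  · rw [← h0]; positivity
  · exact le_of_mul_le_mul_left h2 h0

/-- The error of kernel ridge regression, in terms of the bias and of the deviations of two
sample means. -/
theorem norm_krr_sub_le {lam : ℝ} (hlam : 0 < lam) {n : ℕ} (D : Fin n → X × ℝ) (f fl : H)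
    (hfl : fl = resolvent (LKH hK hH μ) lam (LKH hK hH μ f)) :
    ‖krr H D lam - f‖ ≤ lam * ‖resolvent (LKH hK hH μ) lam f‖ +
      ‖(1 / (n : ℝ)) • (∑ i, ((D i).2 - fl (D i).1) •
          resolventFactor hK hH μ lam (kerSection H (D i).1)) -
        resolventFactor hK hH μ lam (LKH hK hH μ (f - fl))‖ / √lam +
      ‖(1 / (n : ℝ)) • (∑ i, tensorSection hK hH μ lam (D i).1) -
        ∫ x, tensorSection hK hH μ lam x ∂μ‖ *
      ‖(1 / (n : ℝ)) • (∑ i, ((D i).2 - fl (D i).1) •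
          resolventFactor hK hH μ lam (kerSection H (D i).1)) -
        resolventFactor hK hH μ lam (LKH hK hH μ (f - fl))‖ / lam := by
  set T := LKH hK hH μ with hT
  set G := resolvent T lam with hG
  set Φ := resolventFactor hK hH μ lam with hΦ
  have hTn := LKH_nonneg hK hH μ
  let Δ : H := empTarget H D - empOp H D fl - T (f - fl)
  have hΔ : (1 / (n : ℝ)) • (∑ i, ((D i).2 - fl (D i).1) • Φ (kerSection H (D i).1)) -
      Φ (T (f - fl)) = Φ Δ := by
    simp only [Δ]
    rw [map_sub Φ, map_sub Φ, empTarget, empOp_apply, map_smul, map_smul, map_sum, map_sum,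
      ← smul_sub, ← Finset.sum_sub_distrib]
    congr 3
    funext i
    rw [map_smul, map_smul, sub_smul]
  rw [hΔ]
  set Ξ := (1 / (n : ℝ)) • (∑ i, tensorSection hK hH μ lam (D i).1) -
    ∫ x, tensorSection hK hH μ lam x ∂μ with hΞ
  have hbias : f - fl = lam • G f := by
    have h1 := smul_resolvent_add hTn hlam f
    rw [hfl, resolvent_comm hTn hlam]
    nth_rewrite 1 [← h1]
    abel
  have hlfl : lam • fl = T (f - fl) := by
    have h1 := smul_resolvent_add hTn hlam (T f)
    rw [map_sub, eq_sub_iff_add_eq, hfl]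
    exact h1
  set w := krr H D lam - fl - G Δ with hw
  have hN : lam • krr H D lam + empOp H D (krr H D lam) = empTarget H D := by
    rw [krr_eq_resolvent D hlam]
    exact smul_resolvent_add (empOp_nonneg D) hlam _
  -- The residual at `fl` cancels down to Δ by λ fl = T(f - fl). What is left is T_D - T applied to
  -- GΔ, so `w` is a product of two deviations.
  have hwe : lam • w + empOp H D w = -(empOp H D (G Δ) - T (G Δ)) := by
    have h1 : lam • G Δ + T (G Δ) = Δ := smul_resolvent_add hTn hlam Δ
    have h2 : lam • w + empOp H D w = (lam • krr H D lam + empOp H D (krr H D lam)) -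
        lam • fl - empOp H D fl - lam • G Δ - empOp H D (G Δ) := by
      rw [hw, map_sub (empOp H D), map_sub (empOp H D), smul_sub, smul_sub]
      abel
    have h3 : lam • G Δ = Δ - T (G Δ) := eq_sub_of_add_eq h1
    rw [h2, hN, hlfl, h3]
    simp only [Δ]
    abel
  have h1 : lam * ‖w‖ ≤ ‖Ξ‖ * ‖Φ Δ‖ := by
    refine (mul_norm_le_norm_smul_add (empOp_nonneg D) lam w).trans ?_
    rw [hwe, norm_neg]
    exact norm_empOp_sub_LKH_resolvent_le hK hH μ hlam D Δ
  have h2 : √lam * ‖G Δ‖ ≤ ‖Φ Δ‖ := sqrt_mul_norm_resolvent_le hK hH μ hlam Δ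
  have h3 : krr H D lam - f = -(lam • G f) + G Δ + w := by
    rw [hw, ← hbias]
    abel
  rw [h3]
  refine (norm_add_le _ _).trans (add_le_add ((norm_add_le _ _).trans (add_le_add ?_ ?_)) ?_)
  · rw [norm_neg, norm_smul, Real.norm_of_nonneg hlam.le]
  · rw [le_div_iff₀ (Real.sqrt_pos.mpr hlam), mul_comm]
    exact h2
  · rw [le_div_iff₀ hlam, mul_comm]
    exact h1

end ErrorDecomposition

/-! ### The expected error -/

section ExpectedError

theorem integral_fst {X E : Type*} [MeasurableSpace X] (ρ : Measure (X × ℝ))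
    [NormedAddCommGroup E] [NormedSpace ℝ E] {g : X → E}
    (hg : AEStronglyMeasurable g ρ.fst) : ∫ x, g x ∂ρ.fst = ∫ p, g p.1 ∂ρ :=
  integral_map measurable_fst.aemeasurable hg

/-- Bounded measurable functions have square integrable sample means. -/
theorem integrable_norm_sq_mean_sub {Ω Z V : Type*} [MeasurableSpace Ω] {P : Measure Ω}
    [IsProbabilityMeasure P] [MeasurableSpace Z] [NormedAddCommGroup V]
    [NormedSpace ℝ V] {z : ℕ → Ω → Z} (hz : ∀ i, Measurable (z i)) {ψ : Z → V}
    (hψ : StronglyMeasurable ψ) {B : ℝ} (hB : ∀ x, ‖ψ x‖ ≤ B) (n : ℕ) (m : V) :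
    Integrable (fun ω => ‖(1 / (n : ℝ)) • (∑ i : Fin n, ψ (z i ω)) - m‖ ^ 2) P := by
  have h1 : StronglyMeasurable fun ω => (1 / (n : ℝ)) • (∑ i : Fin n, ψ (z i ω)) - m := by
    refine StronglyMeasurable.sub (StronglyMeasurable.const_smul ?_ _) stronglyMeasurable_const
    exact Finset.stronglyMeasurable_fun_sum _ fun i _ => hψ.comp_measurable (hz i)
  refine Integrable.of_bound (h1.norm.pow 2).aestronglyMeasurable
    ((|1 / (n : ℝ)| * (n * B) + ‖m‖) ^ 2) (Eventually.of_forall fun ω => ?_)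
  rw [Real.norm_of_nonneg (sq_nonneg _)]
  refine pow_le_pow_left₀ (norm_nonneg _) ((norm_sub_le _ _).trans ?_) 2
  rw [norm_smul, Real.norm_eq_abs]
  gcongr
  refine (norm_sum_le _ _).trans ?_
  have := Finset.sum_le_card_nsmul (Finset.univ : Finset (Fin n)) (fun i => ‖ψ (z i ω)‖) B
    fun i _ => hB _
  simpa using this

/-- The inequality v/√λ ≤ L/2 + v²/(2Lλ), scaled to the size L of the bias, produces the extra 1/2.
Only squares of v and w then remain to be integrated. -/
theorem le_of_le_add_div {lam L R e v w : ℝ} (hlam : 0 < lam) (hL : 0 < L)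
    (he : e ≤ L * R + v / √lam + w * v / lam) :
    e ≤ L * (R + 1 / 2) + (v ^ 2 / (2 * (L * lam)) + (v ^ 2 + w ^ 2) / (2 * lam)) := by
  have hq : 0 < √lam := Real.sqrt_pos.mpr hlam
  have h2 : v / √lam ≤ L / 2 + v ^ 2 / (2 * (L * lam)) := by
    rw [div_le_iff₀ hq]
    have h4 : (L / 2 + v ^ 2 / (2 * (L * √lam ^ 2))) * √lam - v =
        (L * √lam - v) ^ 2 / (2 * (L * √lam)) := by
      field_simp
      ring
    rw [Real.sq_sqrt hlam.le] at h4
    have h5 : 0 ≤ (L * √lam - v) ^ 2 / (2 * (L * √lam)) := by positivity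
    linarith
  have h6 : w * v / lam ≤ (v ^ 2 + w ^ 2) / (2 * lam) := by
    rw [div_le_div_iff₀ hlam (by positivity)]
    nlinarith [mul_nonneg hlam.le (sq_nonneg (v - w))]
  linarith

variable {X : Type*} [MetricSpace X] [CompactSpace X] [MeasurableSpace X] [BorelSpace X]
  {H : Type*} [NormedAddCommGroup H] [InnerProductSpace ℝ H] [CompleteSpace H] [RKHS ℝ H X ℝ]
  {K : X → X → ℝ} (hK : IsMercerKernel K) (hH : IsRKHSOf H K) (ρ : Measure (X × ℝ))
  [IsProbabilityMeasure ρ]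

theorem isVersion_iff_toL2 {φ : Lp ℝ 2 ρ.fst} (hφ : (φ : X → ℝ) =ᵐ[ρ.fst] regressionFun ρ) (g : H) :
    (g : X → ℝ) =ᵐ[ρ.fst] regressionFun ρ ↔ toL2 hK hH ρ.fst g = φ := by
  constructor
  · intro hg
    exact Lp.ext ((coeFn_toL2 hK hH ρ.fst g).trans (hg.trans hφ.symm))
  · rintro rfl
    exact (coeFn_toL2 hK hH ρ.fst g).symm.trans hφ

/-- Disintegrating ρ replaces y by f(x) after testing against u, which identifies the centre of the
residual mean. The truncation is invisible almost surely, but makes the integrand's label bounded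
everywhere, as the variance bound requires. -/
theorem integral_smul_map_kerSection {E : Type*} [NormedAddCommGroup E] [InnerProductSpace ℝ E]
    [CompleteSpace E] {M : ℝ} (hM : ∀ᵐ p ∂ρ, |p.2| ≤ M) {f : H}
    (hf : (f : X → ℝ) =ᵐ[ρ.fst] regressionFun ρ) (g : H) (Φ : H →L[ℝ] E) :
    ∫ p, (clip M p.2 - g p.1) • Φ (kerSection H p.1) ∂ρ = Φ (LKH hK hH ρ.fst (f - g)) := by
  -- Second countability makes the product σ-field on X × ℝ the Borel one, so continuous functions
  -- on it are measurable.
  have : SecondCountableTopology X := UniformSpace.secondCountable_of_separable X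
  obtain ⟨B, hB0, hB⟩ := exists_bound_kerSection hK hH
  have hk := continuous_kerSection hK hH
  have hk1 : Continuous fun p : X × ℝ => kerSection H p.1 := hk.comp continuous_fst
  have hbd : ∀ u : H, ∀ x, ‖u x‖ ≤ B * ‖u‖ := fun u x => by
    rw [← inner_kerSection]
    exact (norm_inner_le_norm _ _).trans (mul_le_mul_of_nonneg_right (hB x) (norm_nonneg _))
  have hyi : Integrable (fun p : X × ℝ => p.2) ρ :=
    Integrable.of_bound measurable_snd.aestronglyMeasurable M hM
  have hc : ∀ u : H, Continuous fun p : X × ℝ => u p.1 := fun u =>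
    (continuous_coe hK hH u).comp continuous_fst
  have hyu : ∀ u : H, Integrable (fun p : X × ℝ => p.2 * u p.1) ρ := fun u =>
    hyi.mul_bdd (hc u).aestronglyMeasurable (Eventually.of_forall fun p => hbd u p.1)
  have hgu : ∀ u : H, Integrable (fun p : X × ℝ => g p.1 * u p.1) ρ := fun u =>
    (Integrable.of_bound (hc g).aestronglyMeasurable (B * ‖g‖)
      (Eventually.of_forall fun p => hbd g p.1)).mul_bdd (hc u).aestronglyMeasurable
        (Eventually.of_forall fun p => hbd u p.1)
  have hvi : Integrable (fun p : X × ℝ => (p.2 - g p.1) • kerSection H p.1) ρ :=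
    (hyi.sub (Integrable.of_bound (hc g).aestronglyMeasurable (B * ‖g‖)
      (Eventually.of_forall fun p => hbd g p.1))).smul_bdd B hk1.aestronglyMeasurable
        (Eventually.of_forall fun p => hB p.1)
  have h1 : ∫ p, (clip M p.2 - g p.1) • Φ (kerSection H p.1) ∂ρ =
      Φ (∫ p, (p.2 - g p.1) • kerSection H p.1 ∂ρ) := by
    rw [← Φ.integral_comp_comm hvi]
    refine integral_congr_ae ?_
    filter_upwards [hM] with p hp
    rw [clip_of_abs_le hp, map_smul]
  rw [h1]
  congr 1
  refine ext_inner_left ℝ fun u => ?_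
  rw [← integral_inner hvi, inner_LKH, inner_toL2_toL2]
  have h2 : ∀ p : X × ℝ, inner ℝ u ((p.2 - g p.1) • kerSection H p.1) =
      p.2 * u p.1 - g p.1 * u p.1 := fun p => by
    rw [inner_smul_right, real_inner_comm, inner_kerSection, sub_mul]
  simp only [h2]
  have h3 : ∫ p, p.2 * u p.1 ∂ρ = ∫ x, f x * u x ∂ρ.fst := by
    rw [← Measure.integral_condKernel (hyu u)]
    refine integral_congr_ae ?_
    filter_upwards [hf] with x hx
    simp only [integral_mul_const]
    rw [hx, regressionFun]
  have h4 : ∫ p, g p.1 * u p.1 ∂ρ = ∫ x, g x * u x ∂ρ.fst := by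
    rw [integral_fst]
    exact ((continuous_coe hK hH g).mul (continuous_coe hK hH u)).aestronglyMeasurable
  have hfu : ∀ v : H, Integrable (fun x => v x * u x) ρ.fst := fun v =>
    (memLp_coe hK hH ρ.fst v).integrable_mul (memLp_coe hK hH ρ.fst u)
  rw [integral_sub (hyu u) (hgu u), h3, h4, ← integral_sub (hfu f) (hfu g)]
  refine integral_congr_ae (Eventually.of_forall fun x => ?_)
  simp only [RKHS.coe_sub, Pi.sub_apply]
  ring

variable {Ω : Type*} [MeasurableSpace Ω] {P : Measure Ω} [IsProbabilityMeasure P]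
  {z : ℕ → Ω → X × ℝ}

theorem expected_error_le {κ M C₀ R r s : ℝ} (hκ : 0 ≤ κ) (hM : 0 < M) (hC₀ : 1 ≤ C₀)
    (hKκ : ∀ x, K x x ≤ κ ^ 2) (hz : ∀ i, Measurable (z i)) (hzρ : P.map (z 0) = ρ)
    (hs : IsStationary P z) (hMρ : ∀ᵐ p ∂ρ, |p.2| ≤ M) {lam : ℝ} (hlam : 0 < lam)
    (hN : effectiveDim (LKH hK hH ρ.fst) lam ≤ ENNReal.ofReal (C₀ * lam ^ (-s)))
    {f : H} (hf : (f : X → ℝ) =ᵐ[ρ.fst] regressionFun ρ)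
    (hbias : lam * ‖resolvent (LKH hK hH ρ.fst) lam f‖ ≤ lam ^ (r - 1 / 2) * R)
    {n : ℕ} (hn : 1 ≤ n) :
    Integrable (fun ω => ‖krr H (fun i : Fin n => z i ω) lam - f‖) P ∧
      ∫ ω, ‖krr H (fun i : Fin n => z i ω) lam - f‖ ∂P ≤
        lam ^ (r - 1 / 2) * (R + 1 / 2) +
        (C₀ + 56 * κ ^ 2) * (1 / (n : ℝ)) *
          (lam ^ (-s) + (∑ l ∈ Finset.Icc 1 n, √(mixingCoeff P z l)) / lam) *
          ((M + 2 * κ * ‖f‖) ^ 2 / (2 * (lam ^ (r - 1 / 2) * lam)) +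
            ((M + 2 * κ * ‖f‖) ^ 2 + κ ^ 2) / (2 * lam)) := by
  have : SecondCountableTopology X := UniformSpace.secondCountable_of_separable X
  set T := LKH hK hH ρ.fst with hT
  set Φ := resolventFactor hK hH ρ.fst lam with hΦ
  have hTn := LKH_nonneg hK hH ρ.fst
  set M' := M + 2 * κ * ‖f‖ with hM'
  have hM'0 : 0 ≤ M' := by positivity
  set S := ∑ l ∈ Finset.Icc 1 n, √(mixingCoeff P z l) with hS
  have hS0 : 0 ≤ S := Finset.sum_nonneg fun l _ => Real.sqrt_nonneg _
  set fl := resolvent T lam (T f) with hfl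
  have hfl2 : ‖fl‖ ≤ 2 * ‖f‖ := by
    have h1 := smul_resolvent_add hTn hlam f
    have h2 : fl = f - lam • resolvent T lam f := by
      rw [hfl, resolvent_comm hTn hlam]
      exact eq_sub_of_add_eq' h1
    rw [h2]
    refine (norm_sub_le _ _).trans ?_
    rw [norm_smul, Real.norm_of_nonneg hlam.le]
    linarith [mul_norm_resolvent_le hTn hlam f]
  have hk := continuous_kerSection hK hH
  have hkκ := norm_kerSection_le (H := H) hH hκ hKκ
  have hflx : ∀ x, |fl x| ≤ 2 * κ * ‖f‖ := fun x => by
    rw [← inner_kerSection]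
    refine (abs_real_inner_le_norm _ _).trans ?_
    calc ‖kerSection H x‖ * ‖fl‖ ≤ κ * (2 * ‖f‖) := by
          gcongr
          exact hkκ x
      _ = _ := by ring
  have hΦk : ∀ x, ‖Φ (kerSection H x)‖ ≤ κ / √lam := fun x => by
    rw [le_div_iff₀ (Real.sqrt_pos.mpr hlam), mul_comm]
    exact (sqrt_mul_norm_resolventFactor_le hK hH ρ.fst hlam _).trans (hkκ x)
  have hΦkc : Continuous fun x => Φ (kerSection H x) := Φ.continuous.comp hk
  have hEΦ : ∫ x, ‖Φ (kerSection H x)‖ ^ 2 ∂ρ.fst ≤ C₀ * lam ^ (-s) :=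
    integral_norm_resolventFactor_kerSection_sq_le hK hH ρ.fst hlam (by positivity) hN
  have hEΦ' : ∫ p, ‖Φ (kerSection H p.1)‖ ^ 2 ∂ρ ≤ C₀ * lam ^ (-s) := by
    have hc : Continuous fun x => ‖Φ (kerSection H x)‖ ^ 2 := hΦkc.norm.pow 2
    rw [integral_fst ρ hc.aestronglyMeasurable] at hEΦ
    exact hEΦ
  have hΦi : Integrable (fun p : X × ℝ => ‖Φ (kerSection H p.1)‖ ^ 2) ρ := by
    refine Integrable.of_bound ((hΦkc.comp continuous_fst).norm.pow 2).aestronglyMeasurable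
      ((κ / √lam) ^ 2) (Eventually.of_forall fun p => ?_)
    rw [Real.norm_of_nonneg (sq_nonneg _)]
    exact pow_le_pow_left₀ (norm_nonneg _) (hΦk _) 2
  have hκlam : (κ / √lam) ^ 2 = κ ^ 2 / lam := by rw [div_pow, Real.sq_sqrt hlam.le]
  have hzlam : 0 < lam ^ (-s) := Real.rpow_pos_of_pos hlam _
  -- the mean square of a sample mean of a function dominated by `Φ K_x`
  have key : ∀ (b v : ℝ), 0 ≤ b → v ≤ b ^ 2 * (C₀ * lam ^ (-s)) →
      1 / (n : ℝ) * (v + 56 * (b * (κ / √lam)) ^ 2 * S) ≤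
        (C₀ + 56 * κ ^ 2) * (1 / (n : ℝ)) * (lam ^ (-s) + S / lam) * b ^ 2 := by
    intro b v hb hv
    rw [mul_pow, hκlam]
    have h1 : (0 : ℝ) ≤ 1 / n := by positivity
    have h2 : v + 56 * (b ^ 2 * (κ ^ 2 / lam)) * S ≤
        (C₀ + 56 * κ ^ 2) * (lam ^ (-s) + S / lam) * b ^ 2 := by
      have h3 : 0 ≤ b ^ 2 * (56 * κ ^ 2 * lam ^ (-s) + C₀ * (S / lam)) := by positivity
      have h4 : 56 * (b ^ 2 * (κ ^ 2 / lam)) * S = b ^ 2 * (56 * κ ^ 2 * (S / lam)) := by ring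
      rw [h4]
      linarith
    calc _ ≤ 1 / (n : ℝ) * ((C₀ + 56 * κ ^ 2) * (lam ^ (-s) + S / lam) * b ^ 2) := by gcongr
      _ = _ := by ring
  -- `ψ₁` is the truncated residual times ΦK_x and `ψ₂` the tensor K_x ⊗ ΦK_x. Both norms are at
  -- most a constant, M' or κ, times ‖ΦK_x‖, so `key` serves for both variances.
  let ψ₁ : X × ℝ → WithLp 2 (Lp ℝ 2 ρ.fst × H) := fun p =>
    (clip M p.2 - fl p.1) • Φ (kerSection H p.1)
  have hψ₁c : Continuous ψ₁ :=
    (((continuous_clip M).comp continuous_snd).sub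
      ((continuous_coe hK hH fl).comp continuous_fst)).smul (hΦkc.comp continuous_fst)
  let ψ₂ : X × ℝ → _ := fun p => tensorSection hK hH ρ.fst lam p.1
  have hψ₂c : Continuous ψ₂ := (continuous_tensorSection hK hH ρ.fst lam).comp continuous_fst
  have hcoef : ∀ p : X × ℝ, |clip M p.2 - fl p.1| ≤ M' := fun p => by
    refine (abs_sub _ _).trans ?_
    exact add_le_add (abs_clip_le hM.le _) (hflx _)
  have hψ₁n : ∀ p, ‖ψ₁ p‖ ≤ M' * ‖Φ (kerSection H p.1)‖ := fun p => by
    simp only [ψ₁]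
    rw [norm_smul]
    exact mul_le_mul_of_nonneg_right (hcoef p) (norm_nonneg _)
  have hψ₂n : ∀ p, ‖ψ₂ p‖ ≤ κ * ‖Φ (kerSection H p.1)‖ := fun p => by
    simp only [ψ₂]
    rw [norm_tensorSection]
    exact mul_le_mul_of_nonneg_right (hkκ _) (norm_nonneg _)
  have hψ₁B : ∀ p, ‖ψ₁ p‖ ≤ M' * (κ / √lam) := fun p =>
    (hψ₁n p).trans (mul_le_mul_of_nonneg_left (hΦk _) hM'0)
  have hψ₂B : ∀ p, ‖ψ₂ p‖ ≤ κ * (κ / √lam) := fun p =>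
    (hψ₂n p).trans (mul_le_mul_of_nonneg_left (hΦk _) hκ)
  have hsq : ∀ {V : Type _} [NormedAddCommGroup V] (ψ : X × ℝ → V) (b : ℝ),
      (∀ p, ‖ψ p‖ ≤ b * ‖Φ (kerSection H p.1)‖) →
      ∫ p, ‖ψ p‖ ^ 2 ∂ρ ≤ b ^ 2 * (C₀ * lam ^ (-s)) := by
    intro V _ ψ b hψ
    calc ∫ p, ‖ψ p‖ ^ 2 ∂ρ ≤ ∫ p, b ^ 2 * ‖Φ (kerSection H p.1)‖ ^ 2 ∂ρ := by
          refine integral_mono_of_nonneg (Eventually.of_forall fun _ => sq_nonneg _)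
            (hΦi.const_mul _) (Eventually.of_forall fun p => ?_)
          simp only
          rw [← mul_pow]
          exact pow_le_pow_left₀ (norm_nonneg _) (hψ p) 2
      _ ≤ _ := by
          rw [integral_const_mul]
          exact mul_le_mul_of_nonneg_left hEΦ' (sq_nonneg _)
  have hV₁ := (integral_norm_sq_mean_sub_le hz hs hzρ hψ₁c.stronglyMeasurable hψ₁B hn).trans
    (key M' _ hM'0 (hsq ψ₁ M' hψ₁n))
  have hV₂ := (integral_norm_sq_mean_sub_le hz hs hzρ hψ₂c.stronglyMeasurable hψ₂B hn).trans
    (key κ _ hκ (hsq ψ₂ κ hψ₂n))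
  have hI₁ := integrable_norm_sq_mean_sub (P := P) hz hψ₁c.stronglyMeasurable hψ₁B n
    (∫ p, ψ₁ p ∂ρ)
  have hI₂ := integrable_norm_sq_mean_sub (P := P) hz hψ₂c.stronglyMeasurable hψ₂B n
    (∫ p, ψ₂ p ∂ρ)
  set Q := (C₀ + 56 * κ ^ 2) * (1 / (n : ℝ)) * (lam ^ (-s) + S / lam) with hQ
  set W₁ : Ω → ℝ := fun ω => ‖(1 / (n : ℝ)) • (∑ i : Fin n, ψ₁ (z i ω)) - ∫ p, ψ₁ p ∂ρ‖ with hW₁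
  set W₂ : Ω → ℝ := fun ω => ‖(1 / (n : ℝ)) • (∑ i : Fin n, ψ₂ (z i ω)) - ∫ p, ψ₂ p ∂ρ‖ with hW₂
  have hm₁ : ∫ p, ψ₁ p ∂ρ = Φ (T (f - fl)) :=
    integral_smul_map_kerSection hK hH ρ hMρ hf fl Φ
  have hm₂ : ∫ p, ψ₂ p ∂ρ = ∫ x, tensorSection hK hH ρ.fst lam x ∂ρ.fst := by
    rw [integral_fst ρ (integrable_tensorSection hK hH ρ.fst lam).aestronglyMeasurable]
  set L := lam ^ (r - 1 / 2) with hL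
  have hL0 : 0 < L := Real.rpow_pos_of_pos hlam _
  have hae : ∀ᵐ ω ∂P, ∀ i, |(z i ω).2| ≤ M := by
    rw [ae_all_iff]
    intro i
    refine ae_of_ae_map (hz i).aemeasurable (p := fun p : X × ℝ => |p.2| ≤ M) ?_
    rw [hs.map_eq i, hzρ]
    exact hMρ
  have hpt : ∀ᵐ ω ∂P, ‖krr H (fun i : Fin n => z i ω) lam - f‖ ≤
      L * (R + 1 / 2) + (W₁ ω ^ 2 / (2 * (L * lam)) + (W₁ ω ^ 2 + W₂ ω ^ 2) / (2 * lam)) := by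
    filter_upwards [hae] with ω hω
    have h1 := norm_krr_sub_le hK hH ρ.fst hlam (fun i : Fin n => z i ω) f fl hfl
    have e1 : ‖(1 / (n : ℝ)) • (∑ i : Fin n, ((z i ω).2 - fl (z i ω).1) •
        resolventFactor hK hH ρ.fst lam (kerSection H (z i ω).1)) -
        resolventFactor hK hH ρ.fst lam (LKH hK hH ρ.fst (f - fl))‖ = W₁ ω := by
      simp only [hW₁, hm₁, ψ₁]
      simp only [clip_of_abs_le (hω _)]
      rfl
    have e2 : ‖(1 / (n : ℝ)) • (∑ i : Fin n, tensorSection hK hH ρ.fst lam (z i ω).1) -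
        ∫ x, tensorSection hK hH ρ.fst lam x ∂ρ.fst‖ = W₂ ω := by
      simp only [hW₂, hm₂, ψ₂]
    rw [e1, e2] at h1
    exact le_of_le_add_div hlam hL0 (h1.trans (by gcongr))
  have hIbd : Integrable (fun ω => L * (R + 1 / 2) + (W₁ ω ^ 2 / (2 * (L * lam)) +
      (W₁ ω ^ 2 + W₂ ω ^ 2) / (2 * lam))) P :=
    (integrable_const _).add ((hI₁.div_const _).add ((hI₁.add hI₂).div_const _))
  have hmeas : AEStronglyMeasurable (fun ω => ‖krr H (fun i : Fin n => z i ω) lam - f‖) P := by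
    have h1 : Continuous fun D : Fin n → X × ℝ => ‖krr H D lam - f‖ :=
      ((continuous_krr hK hH n hlam).sub continuous_const).norm
    exact (h1.measurable.comp (measurable_pi_lambda _ fun i => hz i)).aestronglyMeasurable
  refine ⟨hIbd.mono' hmeas ?_, ?_⟩
  · filter_upwards [hpt] with ω hω
    rwa [norm_norm]
  · refine (integral_mono_of_nonneg (Eventually.of_forall fun _ => norm_nonneg _) hIbd hpt).trans ?_
    have i1 : Integrable (fun ω => W₁ ω ^ 2 / (2 * (L * lam))) P := hI₁.div_const _
    have i2 : Integrable (fun ω => (W₁ ω ^ 2 + W₂ ω ^ 2) / (2 * lam)) P :=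
      (hI₁.add hI₂).div_const _
    have i3 : Integrable (fun ω => W₁ ω ^ 2 / (2 * (L * lam)) +
        (W₁ ω ^ 2 + W₂ ω ^ 2) / (2 * lam)) P := i1.add i2
    rw [integral_add (integrable_const _) i3, integral_add i1 i2, integral_div,
      integral_div, integral_add hI₁ hI₂]
    simp only [integral_const, probReal_univ, one_smul]
    have e : Q * (M' ^ 2 / (2 * (L * lam)) + (M' ^ 2 + κ ^ 2) / (2 * lam)) =
        Q * M' ^ 2 / (2 * (L * lam)) + (Q * M' ^ 2 + Q * κ ^ 2) / (2 * lam) := by ring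
    rw [e]
    gcongr

end ExpectedError

/-! ### Rates -/

section Rates

/-- N plays the role of 1/n. The choice of λ means N λ^(-s) = λ^(2r) = L²λ, so the variance factor
equals L²λq. Division by Lλ leaves Lq, the order of the bias times q; division by λ leaves L²q ≤ Lq,
because L ≤ 1. -/
theorem error_bound_le {lam L A Rc q m κ N S r s : ℝ} (hlam : 0 < lam) (hlam1 : lam ≤ 1)
    (hr : 1 / 2 ≤ r) (hL : L = lam ^ (r - 1 / 2)) (hN : N = lam ^ (2 * r + s)) (hA : 0 ≤ A)
    (hRc : 0 ≤ Rc) (hS : 0 ≤ S) (hq : q = 1 + S * lam ^ (s - 1)) :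
    L * Rc + A * N * (lam ^ (-s) + S / lam) * (m ^ 2 / (2 * (L * lam)) + (m ^ 2 + κ ^ 2) / (2 * lam))
      ≤ (Rc + A * (m ^ 2 + κ ^ 2)) * (L * q) := by
  have hL0 : 0 < L := hL ▸ Real.rpow_pos_of_pos hlam _
  have hL1 : L ≤ 1 := hL ▸ Real.rpow_le_one hlam.le hlam1 (by linarith)
  have hp : 0 < lam ^ (s - 1) := Real.rpow_pos_of_pos hlam _
  have hq1 : 1 ≤ q := by rw [hq]; nlinarith [mul_nonneg hS hp.le]
  have h1 : N * (lam ^ (-s) + S / lam) = L ^ 2 * lam * q := by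
    have e1 : L ^ 2 * lam = lam ^ (2 * r) := by
      rw [hL, ← Real.rpow_natCast, ← Real.rpow_mul hlam.le, ← Real.rpow_add_one hlam.ne']
      congr 1
      push_cast
      ring
    have e2 : N * lam ^ (-s) = lam ^ (2 * r) := by
      rw [hN, ← Real.rpow_add hlam]
      congr 1
      ring
    have e3 : N / lam = lam ^ (2 * r) * lam ^ (s - 1) := by
      rw [hN, ← Real.rpow_add hlam, ← Real.rpow_sub_one hlam.ne']
      congr 1
      ring
    calc N * (lam ^ (-s) + S / lam) = N * lam ^ (-s) + S * (N / lam) := by ring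
      _ = _ := by rw [e1, e2, e3, hq]; ring
  have h2 : A * N * (lam ^ (-s) + S / lam) *
      (m ^ 2 / (2 * (L * lam)) + (m ^ 2 + κ ^ 2) / (2 * lam)) =
      A * (q * L) * ((m ^ 2 + L * (m ^ 2 + κ ^ 2)) / 2) := by
    rw [mul_assoc A N, h1]
    field_simp
  have h3 : (m ^ 2 + L * (m ^ 2 + κ ^ 2)) / 2 ≤ m ^ 2 + κ ^ 2 := by
    nlinarith [sq_nonneg m, sq_nonneg κ, mul_le_mul_of_nonneg_right hL1
      (add_nonneg (sq_nonneg m) (sq_nonneg κ))]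
  have h4 : L * Rc ≤ Rc * (L * q) := by nlinarith [mul_nonneg hL0.le hRc]
  have h5 : A * (q * L) * ((m ^ 2 + L * (m ^ 2 + κ ^ 2)) / 2) ≤ A * (q * L) * (m ^ 2 + κ ^ 2) :=
    mul_le_mul_of_nonneg_left h3 (by positivity)
  rw [h2]
  linarith

/-- On the left S carries the exponent (3/2 - r - s)/(2r + s), no larger than the one in the second
factor on the right. Of the first factor only the lower bound 1 is needed. -/
theorem rate_le {n : ℕ} (hn : 1 ≤ n) {r s δ S S' : ℝ} (hr : 1 / 2 ≤ r) (hs : 0 < s) (hδ : 0 < δ)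
    (hS : 0 ≤ S) (hSS' : S ≤ S') :
    ((n : ℝ) ^ (-1 / (2 * r + s))) ^ (r - 1 / 2) *
        (1 + S * ((n : ℝ) ^ (-1 / (2 * r + s))) ^ (s - 1)) ≤
      (1 + (n : ℝ) ^ ((s + 1) * (δ + 1) / ((2 * r + s) * (δ + 2))) * S') *
        ((n : ℝ) ^ (-((r - 1 / 2) / (2 * r + s))) +
          (n : ℝ) ^ ((2 * (s + 1) * (δ + 1) + δ + 2) / ((2 * r + s) * (2 * δ + 4))) * S') := by
  have hn1 : (1 : ℝ) ≤ n := by exact_mod_cast hn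
  have hn0 : (0 : ℝ) < n := by linarith
  have hd : 0 < 2 * r + s := by linarith
  have hS' : 0 ≤ S' := hS.trans hSS'
  rw [mul_add, mul_one, ← Real.rpow_mul hn0.le, ← Real.rpow_mul hn0.le]
  have e1 : -1 / (2 * r + s) * (r - 1 / 2) = -((r - 1 / 2) / (2 * r + s)) := by ring
  rw [e1]
  have e2 : (n : ℝ) ^ (-((r - 1 / 2) / (2 * r + s))) *
      (S * (n : ℝ) ^ (-1 / (2 * r + s) * (s - 1))) =
      (n : ℝ) ^ ((3 / 2 - r - s) / (2 * r + s)) * S := by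
    rw [mul_left_comm, ← Real.rpow_add hn0, mul_comm]
    congr 2
    field_simp
    ring
  rw [e2]
  have h1 : (3 / 2 - r - s) / (2 * r + s) ≤
      (2 * (s + 1) * (δ + 1) + δ + 2) / ((2 * r + s) * (2 * δ + 4)) := by
    rw [div_le_div_iff₀ hd (by positivity)]
    have h2 : (3 / 2 - r - s) * (2 * δ + 4) ≤ 2 * (s + 1) * (δ + 1) + δ + 2 := by
      nlinarith [mul_pos hs hδ]
    calc (3 / 2 - r - s) * ((2 * r + s) * (2 * δ + 4))
        = (3 / 2 - r - s) * (2 * δ + 4) * (2 * r + s) := by ring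
      _ ≤ _ := by gcongr
  have h3 : (n : ℝ) ^ ((3 / 2 - r - s) / (2 * r + s)) * S ≤
      (n : ℝ) ^ ((2 * (s + 1) * (δ + 1) + δ + 2) / ((2 * r + s) * (2 * δ + 4))) * S' :=
    mul_le_mul (Real.rpow_le_rpow_of_exponent_le hn1 h1) hSS' hS (by positivity)
  refine (add_le_add_right h3 _).trans (le_mul_of_one_le_left (by positivity) ?_)
  exact le_add_of_nonneg_right (by positivity)

/-- On [0, 1] a smaller exponent gives a larger power, and δ/(4 + 2δ) ≤ 1/2. -/
theorem sqrt_mixingCoeff_le {Ω Z : Type*} [MeasurableSpace Ω] [MeasurableSpace Z] {P : Measure Ω}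
    [IsProbabilityMeasure P] {z : ℕ → Ω → Z} {δ : ℝ} (hδ : 0 < δ) (l : ℕ) :
    √(mixingCoeff P z l) ≤ mixingCoeff P z l ^ (δ / (4 + 2 * δ)) := by
  rw [Real.sqrt_eq_rpow]
  refine Real.rpow_le_rpow_of_exponent_ge' (mixingCoeff_nonneg l) (mixingCoeff_le_one l)
    (by positivity) ?_
  rw [div_le_div_iff₀ (by positivity) (by positivity)]
  linarith

end Rates

end

end KRR

theorem theorem1 (κ M C₀ R δ r s : ℝ) (hκ : 0 ≤ κ) (hM : 0 < M) (hC₀ : 1 ≤ C₀) (hR : 0 ≤ R)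
    (hδ : 0 < δ) (hr : 1 / 2 ≤ r) (hr' : r ≤ 1) (hs : 0 < s) (hs' : s ≤ 1) :
    ∃ C : ℝ, 0 < C ∧
      ∀ (X : Type*) [MetricSpace X] [CompactSpace X] [MeasurableSpace X] [BorelSpace X]
        (K : X → X → ℝ) (hK : KRR.IsMercerKernel K) (_ : ∀ x, K x x ≤ κ ^ 2)
        (H : Type*) [NormedAddCommGroup H] [InnerProductSpace ℝ H] [CompleteSpace H]
        [RKHS ℝ H X ℝ] (hH : KRR.IsRKHSOf H K)
        (Ω : Type*) [MeasurableSpace Ω] (P : Measure Ω) [IsProbabilityMeasure P]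
        (z : ℕ → Ω → X × ℝ) (_ : ∀ i, Measurable (z i))
        (ρ : Measure (X × ℝ)) [IsProbabilityMeasure ρ] (_ : P.map (z 0) = ρ)
        (_ : KRR.IsStationary P z) (_ : KRR.IsStronglyMixing P z)
        (_ : ∀ᵐ p ∂ρ, |p.2| ≤ M)
        (_ : ∀ lam : ℝ, 0 < lam →
          KRR.effectiveDim (KRR.LKH hK hH ρ.fst) lam ≤ ENNReal.ofReal (C₀ * lam ^ (-s)))
        (h fρ : Lp ℝ 2 ρ.fst) (_ : (fρ : X → ℝ) =ᵐ[ρ.fst] KRR.regressionFun ρ)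
        (_ : KRR.IsPowApply (KRR.LK2 hK hH ρ.fst) r h fρ) (_ : ‖h‖ ≤ R),
        ∃ f : H, KRR.IsVersion ρ.fst (KRR.regressionFun ρ) f ∧
          ∀ n : ℕ, 1 ≤ n →
            Integrable (fun ω => ‖KRR.krr H (fun i : Fin n => z i ω)
              ((n : ℝ) ^ (-1 / (2 * r + s))) - f‖) P ∧
            ∫ ω, ‖KRR.krr H (fun i : Fin n => z i ω)
                ((n : ℝ) ^ (-1 / (2 * r + s))) - f‖ ∂P ≤
              C * (1 + (n : ℝ) ^ ((s + 1) * (δ + 1) / ((2 * r + s) * (δ + 2))) *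
                    ∑ l ∈ Finset.Icc 1 n, KRR.mixingCoeff P z l ^ (δ / (4 + 2 * δ))) *
                ((n : ℝ) ^ (-((r - 1 / 2) / (2 * r + s))) +
                  (n : ℝ) ^ ((2 * (s + 1) * (δ + 1) + δ + 2) / ((2 * r + s) * (2 * δ + 4))) *
                    ∑ l ∈ Finset.Icc 1 n, KRR.mixingCoeff P z l ^ (δ / (4 + 2 * δ))) := by
  -- R + 1/2 comes from the bias and the splitting of W₁/√λ, C₀ + 56κ² from the variance bound, and
  -- the last factor from the bounds M + 2κ‖f‖ on the residual and κ on K_x, with ‖f‖ ≤ (1 + κ²)R.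
  -- None of δ, r, s enters.
  refine ⟨R + 1 / 2 + (C₀ + 56 * κ ^ 2) * ((M + 2 * κ * ((1 + κ ^ 2) * R)) ^ 2 + κ ^ 2),
    by positivity, ?_⟩
  intro X _ _ _ _ K hK hKκ H _ _ _ _ hH Ω _ P _ z hz ρ _ hzρ hst _ hMρ hN h fρ hfρ hpow hhR
  obtain ⟨f, hf, hmin, hfn, hbias⟩ :=
    KRR.exists_version_of_isPowApply hK hH ρ.fst hκ hKκ hr hr' hpow
  have hfv := (KRR.isVersion_iff_toL2 hK hH ρ hfρ f).mpr hf
  refine ⟨f, ⟨hfv, fun g hg => hmin g ((KRR.isVersion_iff_toL2 hK hH ρ hfρ g).mp hg)⟩, ?_⟩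
  intro n hn
  have hn1 : (1 : ℝ) ≤ n := by exact_mod_cast hn
  have hn0 : (0 : ℝ) < n := by linarith
  have hd : 0 < 2 * r + s := by linarith
  set lam : ℝ := (n : ℝ) ^ (-1 / (2 * r + s)) with hlam_def
  have hlam : 0 < lam := Real.rpow_pos_of_pos hn0 _
  have hlam1 : lam ≤ 1 := Real.rpow_le_one_of_one_le_of_nonpos hn1
    (div_nonpos_of_nonpos_of_nonneg (by norm_num) hd.le)
  have hnlam : 1 / (n : ℝ) = lam ^ (2 * r + s) := by
    rw [hlam_def, ← Real.rpow_mul hn0.le, div_mul_cancel₀ _ hd.ne', Real.rpow_neg_one, one_div]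
  have hfR : ‖f‖ ≤ (1 + κ ^ 2) * R := by
    refine le_of_sq_le_sq (hfn.trans ?_) (by positivity)
    -- Enlarging 1 + κ² to its square avoids a square root in the constant.
    calc (1 + κ ^ 2) * ‖h‖ ^ 2 ≤ (1 + κ ^ 2) * R ^ 2 := by gcongr
      _ ≤ (1 + κ ^ 2) ^ 2 * R ^ 2 := by
        gcongr
        nlinarith [sq_nonneg κ]
      _ = _ := by ring
  have hbias' := (hbias lam hlam).trans
    (mul_le_mul_of_nonneg_left hhR (Real.rpow_nonneg hlam.le _))
  obtain ⟨hI, hE⟩ := KRR.expected_error_le hK hH ρ hκ hM hC₀ hKκ hz hzρ hst hMρ hlam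
    (hN lam hlam) hfv hbias' hn
  refine ⟨hI, hE.trans ?_⟩
  have hS : 0 ≤ ∑ l ∈ Finset.Icc 1 n, √(KRR.mixingCoeff P z l) :=
    Finset.sum_nonneg fun l _ => Real.sqrt_nonneg _
  have hb := KRR.error_bound_le (L := lam ^ (r - 1 / 2)) (A := C₀ + 56 * κ ^ 2) (Rc := R + 1 / 2)
    (m := M + 2 * κ * ‖f‖) (κ := κ) hlam hlam1 hr rfl hnlam (by positivity) (by positivity) hS rfl
  refine hb.trans ?_
  rw [mul_assoc _ (1 + (n : ℝ) ^ ((s + 1) * (δ + 1) / ((2 * r + s) * (δ + 2))) * _)]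
  refine mul_le_mul ?_ (KRR.rate_le hn hr hs hδ hS
    (Finset.sum_le_sum fun l _ => KRR.sqrt_mixingCoeff_le hδ l)) (by positivity) (by positivity)
  gcongr
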